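/- **Setting.** Let $n\ge 2$, write $x=(x',x_n)\in\mathbb R^n$, and let $\mathbf C=B(0,1)\times\mathbb R$, where $B(0,1)$ is the open unit ball of $\mathbb R^{n-1}$. Let $\Omega\subset\mathbb R^n$ be a nozzle: an open set for which there are $0<\alpha<1$, $K>0$ and an invertible $C^{2,\alpha}$ map $T:\overline\Omega\to\overline{\mathbf C}$ such that $T(\partial\Omega)=\partial\mathbf C$, $T(\Omega\cap\{x_n=k\})=B(0,1)\times\{k\}$ for every $k\in\mathbb R$, and the first and second derivatives of $T$ and $T^{-1}$, as well as the $\alpha$-Hölder seminorms of their second derivatives, are bounded by $K$. For $L>0$ put $$\Omega_L=\{x\in\Omega: |x_n|<L\},\qquad S_L^\pm=\Omega\cap\{x_n=\pm L\},\qquad H_L=\{\psi\in H^1(\Omega_L):\ \psi|_{S_L^-}=0\},$$ where the boundary condition is in the sense of traces. **Gas law and truncation.** Let $p$ be a smooth pressure law on $(0,\infty)$ with $p'>0$ and $p''>0$, and $h(r)=\int_1^r p'(s)/s\,ds$. Units are such that the critical density and the critical sound speed are $1$, i.e. $p'(1)=1$, and the density $\rho(q^2)>0$ at speed $q\in[0,1]$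 is given by Bernoulli's law $\tfrac12q^2+h(\rho(q^2))=\tfrac12$. Let $0<\delta<\tfrac12$ and let $\Theta:[0,\infty)\to\mathbb R$ be a subsonic truncation of $\rho$: $\Theta$ is smooth and nonincreasing, $\Theta(s)=\rho(s)$ for $0\le s<1-2\delta$, $\Theta(s)=\rho(1-\delta)$ for $s>1-\delta$, and the transition is chosen so that ellipticity is kept, i.e. $\Theta(s)+2s\Theta'(s)>0$ for $1-2\delta\le s\le 1-\delta$. Put $F(t)=\frac12\int_0^t\Theta(s)\,ds$ for $t\ge 0$ and, for $m_0>0$ and $\psi\in H_L$, $$J(\psi)=\int_{\Omega_L}F(|\nabla\psi|^2)\,dx-\frac{m_0}{|S_L^+|}\int_{S_L^+}\psi\,dx'.$$ **Theorem.** There is a constant $C>0$, depending on $\Omega$ and $\Theta$ but not on $L$ or $m_0$, such that for every $m_0>0$ and every $L>0$ the functional $J$ has a nonnegative minimizer over $H_L$, and every minimizer $\varphi\in H_L$ satisfies $$\frac1{|\Omega_L|}\int_{\Omega_L}|\nabla\varphi|^2\,dx\le C\,m_0^2 .$$ -/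

import Mathlib

open MeasureTheory Set Filter Topology
open scoped ContDiff

/-! ### Geometry of the nozzle

The space is `ℝⁿ` with `n = d + 1`; the last coordinate `xₙ` is the longitudinal one and the first
`d = n - 1` coordinates form `x'`. -/

/-- The point `(x', t)` of `ℝⁿ`. -/
noncomputable def slicePoint {d : ℕ} (x' : EuclideanSpace ℝ (Fin d)) (t : ℝ) :
    EuclideanSpace ℝ (Fin (d + 1)) :=
  WithLp.toLp 2 (Fin.snoc (fun i => x' i) t : Fin (d + 1) → ℝ)

/-- The infinite unit cylinder `B(0,1) × ℝ`. -/
def unitCylinder (d : ℕ) : Set (EuclideanSpace ℝ (Fin (d + 1))) :=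
  {y | ∑ i : Fin d, (y i.castSucc) ^ 2 < 1}

/-- `f` is twice continuously differentiable on the open set `U`, its derivatives of order one and
two are bounded by `K`, and its second derivative is `α`-Hölder on `U` with constant `K`. -/
structure HasC2HolderBound {d : ℕ} (α K : ℝ) (U : Set (EuclideanSpace ℝ (Fin (d + 1))))
    (f : EuclideanSpace ℝ (Fin (d + 1)) → EuclideanSpace ℝ (Fin (d + 1))) : Prop where
  contDiffOn : ContDiffOn ℝ 2 f U
  bound_one : ∀ x ∈ U, ‖fderiv ℝ f x‖ ≤ K
  bound_two : ∀ x ∈ U, ‖iteratedFDeriv ℝ 2 f x‖ ≤ K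
  holder : ∀ x ∈ U, ∀ y ∈ U,
    ‖iteratedFDeriv ℝ 2 f x - iteratedFDeriv ℝ 2 f y‖ ≤ K * ‖x - y‖ ^ α

/-- `T`, with inverse `S`, maps the closure of `Ω` onto the closed cylinder as in the basic
assumptions on the nozzle. -/
structure IsNozzleMap {d : ℕ} (α K : ℝ) (Ω : Set (EuclideanSpace ℝ (Fin (d + 1))))
    (T S : EuclideanSpace ℝ (Fin (d + 1)) → EuclideanSpace ℝ (Fin (d + 1))) : Prop where
  mapsTo : MapsTo T (closure Ω) (closure (unitCylinder d))
  mapsTo_symm : MapsTo S (closure (unitCylinder d)) (closure Ω)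
  invOn : InvOn S T (closure Ω) (closure (unitCylinder d))
  continuousOn : ContinuousOn T (closure Ω)
  continuousOn_symm : ContinuousOn S (closure (unitCylinder d))
  image_frontier : T '' frontier Ω = frontier (unitCylinder d)
  image_slice : ∀ k : ℝ,
    T '' (Ω ∩ {x | x (Fin.last d) = k}) = unitCylinder d ∩ {y | y (Fin.last d) = k}
  bound : HasC2HolderBound α K Ω T
  bound_symm : HasC2HolderBound α K (unitCylinder d) S

/-- The basic assumptions on the nozzle `Ω`. -/
def IsNozzle {d : ℕ} (Ω : Set (EuclideanSpace ℝ (Fin (d + 1)))) : Prop :=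
  IsOpen Ω ∧ ∃ α ∈ Ioo (0 : ℝ) 1, ∃ (K : ℝ)
    (T S : EuclideanSpace ℝ (Fin (d + 1)) → EuclideanSpace ℝ (Fin (d + 1))), IsNozzleMap α K Ω T S

/-- The truncated nozzle `Ω_L`. -/
def truncNozzle {d : ℕ} (Ω : Set (EuclideanSpace ℝ (Fin (d + 1)))) (L : ℝ) :
    Set (EuclideanSpace ℝ (Fin (d + 1))) :=
  {x ∈ Ω | |x (Fin.last d)| < L}

/-- The cross section `Ω ∩ {xₙ = t}`, as a subset of `ℝⁿ⁻¹`; `S_L^±` is the case `t = ±L`. -/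
def crossSection {d : ℕ} (Ω : Set (EuclideanSpace ℝ (Fin (d + 1)))) (t : ℝ) :
    Set (EuclideanSpace ℝ (Fin d)) :=
  {x' | slicePoint x' t ∈ Ω}

/-! ### The gas and the subsonic truncation -/

/-- A pressure law `p(ρ)`: smooth, with `p' > 0` and `p'' > 0` for `ρ > 0`, in the units in which
the critical density and the critical sound speed are one. -/
structure IsPressureLaw (p : ℝ → ℝ) : Prop where
  smooth : ContDiffOn ℝ ∞ p (Ioi 0)
  deriv_pos : ∀ r : ℝ, 0 < r → 0 < deriv p r
  deriv_two_pos : ∀ r : ℝ, 0 < r → 0 < deriv (deriv p) r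
  critical : deriv p 1 = 1

/-- The enthalpy `h(ρ) = ∫₁^ρ p'(s)/s ds`. -/
noncomputable def enthalpy (p : ℝ → ℝ) (r : ℝ) : ℝ :=
  ∫ s in (1 : ℝ)..r, deriv p s / s

/-- `ρ` is the density as a function of the squared speed `s = q² ∈ [0,1]`, given by Bernoulli's
law `q²/2 + h(ρ) = 1/2`. The constant is the value of the left side at the critical state,
`q = 1`, `ρ = 1`. -/
def IsDensitySpeedRelation (p ρ : ℝ → ℝ) : Prop :=
  ∀ s ∈ Icc (0 : ℝ) 1, 0 < ρ s ∧ s / 2 + enthalpy p (ρ s) = 1 / 2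

/-- `Θ`, a function of `s = q² ≥ 0`, is a subsonic truncation of `ρ` with parameter `δ`: it agrees
with `ρ` for `s < 1 - 2δ`, equals `ρ(1 - δ)` for `s > 1 - δ`, is smooth and nonincreasing, and in
the transition region is chosen so that ellipticity is kept. There, the matrix
`Θ(|v|²) δᵢⱼ + 2 Θ'(|v|²) vᵢ vⱼ` has eigenvalues `Θ(s)` and `Θ(s) + 2 s Θ'(s)`, `s = |v|²`. -/
structure IsSubsonicTruncation (ρ : ℝ → ℝ) (δ : ℝ) (Θ : ℝ → ℝ) : Prop where
  delta_mem : δ ∈ Ioo (0 : ℝ) (1 / 2)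
  smooth : ContDiffOn ℝ ∞ Θ (Ici 0)
  antitone : AntitoneOn Θ (Ici 0)
  eq_density : ∀ s : ℝ, 0 ≤ s → s < 1 - 2 * δ → Θ s = ρ s
  eq_const : ∀ s : ℝ, 1 - δ < s → Θ s = ρ (1 - δ)
  elliptic : ∀ s ∈ Icc (1 - 2 * δ) (1 - δ), 0 < Θ s + 2 * s * deriv Θ s

/-- `F(t) = ½ ∫₀ᵗ Θ(s) ds`. -/
noncomputable def energyDensity (Θ : ℝ → ℝ) (t : ℝ) : ℝ :=
  1 / 2 * ∫ s in (0 : ℝ)..t, Θ s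

/-! ### Sobolev functions and traces -/

/-- `g ∈ L²(U)` is the weak gradient of `u` in the open set `U`. -/
def IsWeakGradient {d : ℕ} (U : Set (EuclideanSpace ℝ (Fin (d + 1))))
    (u : EuclideanSpace ℝ (Fin (d + 1)) → ℝ)
    (g : EuclideanSpace ℝ (Fin (d + 1)) → EuclideanSpace ℝ (Fin (d + 1))) : Prop :=
  MemLp g 2 (volume.restrict U) ∧
    ∀ ζ : EuclideanSpace ℝ (Fin (d + 1)) → ℝ,
      ContDiff ℝ ∞ ζ → HasCompactSupport ζ → tsupport ζ ⊆ U →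
      ∀ v : EuclideanSpace ℝ (Fin (d + 1)),
        ∫ x in U, u x * fderiv ℝ ζ x v = - ∫ x in U, inner ℝ (g x) v * ζ x

/-- `u ∈ H¹(U)`. -/
def MemH1 {d : ℕ} (U : Set (EuclideanSpace ℝ (Fin (d + 1))))
    (u : EuclideanSpace ℝ (Fin (d + 1)) → ℝ) : Prop :=
  MemLp u 2 (volume.restrict U) ∧ ∃ g, IsWeakGradient U u g

open Classical in
/-- The weak gradient `∇u` of `u ∈ H¹(U)` (a.e. unique in `U`). -/
noncomputable def weakGradient {d : ℕ} (U : Set (EuclideanSpace ℝ (Fin (d + 1))))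
    (u : EuclideanSpace ℝ (Fin (d + 1)) → ℝ) :
    EuclideanSpace ℝ (Fin (d + 1)) → EuclideanSpace ℝ (Fin (d + 1)) :=
  if h : ∃ g, IsWeakGradient U u g then h.choose else 0

/-- For `t = ±L`: the function `τ ∈ L²` on the cross section `{xₙ = t}` is the trace of
`u ∈ H¹(Ω_L)` there, that is, the `L²` limit of the restrictions `v_k(·, t)` for some functions
`v_k`, continuously differentiable up to the boundary, that tend to `u` in `H¹(Ω_L)`. -/
def HasTrace {d : ℕ} (Ω : Set (EuclideanSpace ℝ (Fin (d + 1)))) (L t : ℝ)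
    (u : EuclideanSpace ℝ (Fin (d + 1)) → ℝ) (τ : EuclideanSpace ℝ (Fin d) → ℝ) : Prop :=
  MemLp τ 2 (volume.restrict (crossSection Ω t)) ∧
    ∃ v : ℕ → EuclideanSpace ℝ (Fin (d + 1)) → ℝ,
      (∀ k, ContDiff ℝ 1 (v k)) ∧
      Tendsto (fun k => eLpNorm (fun x => v k x - u x) 2
        (volume.restrict (truncNozzle Ω L))) atTop (𝓝 0) ∧
      Tendsto (fun k => eLpNorm
        (fun x => gradient (v k) x - weakGradient (truncNozzle Ω L) u x) 2
        (volume.restrict (truncNozzle Ω L))) atTop (𝓝 0) ∧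
      Tendsto (fun k => eLpNorm (fun x' => v k (slicePoint x' t) - τ x') 2
        (volume.restrict (crossSection Ω t))) atTop (𝓝 0)

open Classical in
/-- The trace of `u ∈ H¹(Ω_L)` on the cross section `{xₙ = t}`, `t = ±L` (a.e. unique there). -/
noncomputable def traceOn {d : ℕ} (Ω : Set (EuclideanSpace ℝ (Fin (d + 1)))) (L t : ℝ)
    (u : EuclideanSpace ℝ (Fin (d + 1)) → ℝ) : EuclideanSpace ℝ (Fin d) → ℝ :=
  if h : ∃ τ, HasTrace Ω L t u τ then h.choose else 0

/-! ### The variational problem -/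

/-- `H_L`: the functions in `H¹(Ω_L)` with zero trace on `S_L^-`. -/
def spaceHL {d : ℕ} (Ω : Set (EuclideanSpace ℝ (Fin (d + 1)))) (L : ℝ) :
    Set (EuclideanSpace ℝ (Fin (d + 1)) → ℝ) :=
  {u | MemH1 (truncNozzle Ω L) u ∧ HasTrace Ω L (-L) u 0}

/-- The functional
`J(ψ) = ∫_{Ω_L} F(|∇ψ|²) dx - (m₀ / |S_L^+|) ∫_{S_L^+} ψ dx'`. -/
noncomputable def functionalJ {d : ℕ} (Ω : Set (EuclideanSpace ℝ (Fin (d + 1)))) (Θ : ℝ → ℝ)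
    (m₀ L : ℝ) (ψ : EuclideanSpace ℝ (Fin (d + 1)) → ℝ) : ℝ :=
  (∫ x in truncNozzle Ω L, energyDensity Θ (‖weakGradient (truncNozzle Ω L) ψ x‖ ^ 2)) -
    m₀ / volume.real (crossSection Ω L) * ∫ x' in crossSection Ω L, traceOn Ω L L ψ x'

/-- `φ ∈ H_L` minimizes `J` over `H_L`. -/
def IsMinimizerJ {d : ℕ} (Ω : Set (EuclideanSpace ℝ (Fin (d + 1)))) (Θ : ℝ → ℝ)
    (m₀ L : ℝ) (φ : EuclideanSpace ℝ (Fin (d + 1)) → ℝ) : Prop :=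
  φ ∈ spaceHL Ω L ∧ ∀ ψ ∈ spaceHL Ω L, functionalJ Ω Θ m₀ L φ ≤ functionalJ Ω Θ m₀ L ψ

open scoped ENNReal NNReal

/-! ### Slices and the cylinder -/

section Slices

variable {d : ℕ}

/-! Ellipticity of the truncation makes `v ↦ F(|v|²)` uniformly convex: for some λ > 0 the function
F(r²) − λr²/2 is convex and nondecreasing on [0,∞) (`IsSubsonicTruncation.exists_isElliptic`,
`IsElliptic.energyDensity_midpoint_le`). Below the truncation this comes from differentiating
Bernoulli's law; above it Θ is a positive constant.

The energy bound compares a minimizer φ with 0: J(φ) ≤ 0 gives (λ/2)∫|∇φ|² ≤ (m₀/|S_L^+|)∫φ over the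
outlet. In the coordinates of the nozzle map, every outlet point is joined by a line to the inlet,
where φ vanishes, so the outlet integral is at most c∫|∇φ| with c depending only on n and K
(`exists_flux_le`). Working in L¹ keeps L out of c; Cauchy–Schwarz then produces exactly the factor
|Ω_L| of the average. The areas |S_L^+| are bounded below (`exists_le_volume_crossSection`).

Existence is the direct method with strong convergence. Estimates are proved for C¹ functions and
pass to `spaceHL`, since the definition of the inlet trace supplies C¹ approximants with inlet
values tending to 0. For C¹ functions minimizing under a shrinking bound at the inlet, strong
convexity (`IsSliceMap.smoothJ_midpoint_le`) makes the gradients Cauchy, the Poincaré inequality the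
functions, and the trace inequality the outlet values. Nonnegativity comes from replacing a
competitor v by √(v² + ε²) − ε, which shortens gradients and lowers outlet values by at most ε. -/

@[simp] lemma slicePoint_castSucc (x' : EuclideanSpace ℝ (Fin d)) (t : ℝ) (i : Fin d) :
    slicePoint x' t i.castSucc = x' i := by
  simp [slicePoint]

@[simp] lemma slicePoint_last (x' : EuclideanSpace ℝ (Fin d)) (t : ℝ) :
    slicePoint x' t (Fin.last d) = t := by
  simp [slicePoint]

/-- The first `d` coordinates of a point of `ℝᵈ⁺¹`. -/
noncomputable def dropLast (d : ℕ) :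
    EuclideanSpace ℝ (Fin (d + 1)) →L[ℝ] EuclideanSpace ℝ (Fin d) :=
  LinearMap.toContinuousLinearMap
    { toFun := fun x => WithLp.toLp 2 (fun i => x i.castSucc)
      map_add' := fun x y => by ext i; simp
      map_smul' := fun c x => by ext i; simp }

@[simp] lemma dropLast_apply (x : EuclideanSpace ℝ (Fin (d + 1))) (i : Fin d) :
    dropLast d x i = x i.castSucc := rfl

/-- The embedding `x' ↦ (x', 0)`. -/
noncomputable def zeroSlice (d : ℕ) :
    EuclideanSpace ℝ (Fin d) →L[ℝ] EuclideanSpace ℝ (Fin (d + 1)) :=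
  LinearMap.toContinuousLinearMap
    { toFun := fun x' => slicePoint x' 0
      map_add' := fun x y => by
        ext i; refine Fin.lastCases ?_ (fun j => ?_) i <;> simp
      map_smul' := fun c x => by
        ext i; refine Fin.lastCases ?_ (fun j => ?_) i <;> simp }

/-- The longitudinal unit vector. -/
noncomputable def axisVector (d : ℕ) : EuclideanSpace ℝ (Fin (d + 1)) := slicePoint 0 1

lemma slicePoint_eq (x' : EuclideanSpace ℝ (Fin d)) (t : ℝ) :
    slicePoint x' t = zeroSlice d x' + t • axisVector d := by
  ext i
  refine Fin.lastCases ?_ (fun j => ?_) i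
  · simp [zeroSlice, axisVector]
  · simp [zeroSlice, axisVector]

@[simp] lemma dropLast_slicePoint (x' : EuclideanSpace ℝ (Fin d)) (t : ℝ) :
    dropLast d (slicePoint x' t) = x' := by
  ext i; simp

@[simp] lemma slicePoint_dropLast (x : EuclideanSpace ℝ (Fin (d + 1))) :
    slicePoint (dropLast d x) (x (Fin.last d)) = x := by
  ext i
  refine Fin.lastCases ?_ (fun j => ?_) i <;> simp

lemma slicePoint_dropLast_of_eq {x : EuclideanSpace ℝ (Fin (d + 1))} {t : ℝ}
    (h : x (Fin.last d) = t) : slicePoint (dropLast d x) t = x := by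
  rw [← h, slicePoint_dropLast]

lemma norm_axisVector : ‖axisVector d‖ = 1 := by
  rw [EuclideanSpace.norm_eq, Fin.sum_univ_castSucc]
  simp [axisVector]

lemma continuous_slicePoint :
    Continuous fun q : EuclideanSpace ℝ (Fin d) × ℝ => slicePoint q.1 q.2 := by
  simp only [slicePoint_eq]
  fun_prop

/-- A composition of volume-preserving maps: forget the Euclidean norm, swap the factors, insert the
last coordinate, restore the norm. -/
lemma measurePreserving_slicePoint :
    MeasurePreserving (fun q : EuclideanSpace ℝ (Fin d) × ℝ => slicePoint q.1 q.2) := by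
  have h1 := (volume_preserving_piFinSuccAbove (fun _ : Fin (d + 1) => ℝ) (Fin.last d)).symm
  have h2 := (PiLp.volume_preserving_ofLp (Fin d)).prod (MeasurePreserving.id (volume : Measure ℝ))
  have h3 := (PiLp.volume_preserving_toLp (Fin (d + 1))).comp
    (h1.comp (Measure.measurePreserving_swap.comp h2))
  rw [Measure.volume_eq_prod]
  convert h3 using 1
  funext q
  ext i
  refine Fin.lastCases ?_ (fun j => ?_) i
  · simp [MeasurableEquiv.piFinSuccAbove, Fin.insertNthEquiv]
  · simp [MeasurableEquiv.piFinSuccAbove, Fin.insertNthEquiv]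

lemma isOpen_unitCylinder : IsOpen (unitCylinder d) := by
  refine isOpen_lt ?_ continuous_const
  fun_prop

lemma convex_unitCylinder : Convex ℝ (unitCylinder d) := by
  have h : unitCylinder d = (dropLast d) ⁻¹' Metric.ball 0 1 := by
    ext y
    simp only [unitCylinder, mem_ofPred_eq, mem_preimage, mem_ball_zero_iff]
    rw [EuclideanSpace.norm_eq, Real.sqrt_lt' one_pos]
    simp
  rw [h]
  exact (convex_ball _ _).linear_preimage (dropLast d).toLinearMap

/-- The cylinder in terms of slices. -/
lemma slicePoint_mem_unitCylinder {x' : EuclideanSpace ℝ (Fin d)} {t : ℝ} :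
    slicePoint x' t ∈ unitCylinder d ↔ x' ∈ Metric.ball (0 : EuclideanSpace ℝ (Fin d)) 1 := by
  simp only [unitCylinder, mem_ofPred_eq, mem_ball_zero_iff, slicePoint_castSucc]
  rw [EuclideanSpace.norm_eq, Real.sqrt_lt' one_pos]
  simp

lemma isOpen_truncNozzle {Ω : Set (EuclideanSpace ℝ (Fin (d + 1)))} (hΩ : IsOpen Ω) (L : ℝ) :
    IsOpen (truncNozzle Ω L) :=
  hΩ.inter (isOpen_lt (f := fun x : EuclideanSpace ℝ (Fin (d + 1)) => |x (Fin.last d)|)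
    (by fun_prop) continuous_const)

lemma isOpen_crossSection {Ω : Set (EuclideanSpace ℝ (Fin (d + 1)))} (hΩ : IsOpen Ω) (t : ℝ) :
    IsOpen (crossSection Ω t) :=
  hΩ.preimage (continuous_slicePoint.comp (Continuous.prodMk_left t))

lemma crossSection_unitCylinder (t : ℝ) :
    crossSection (unitCylinder d) t = Metric.ball 0 1 := by
  ext x'
  exact slicePoint_mem_unitCylinder

/-- Fubini on the truncated cylinder. -/
lemma lintegral_truncCylinder (L : ℝ) {f : EuclideanSpace ℝ (Fin (d + 1)) → ℝ≥0∞}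
    (hf : AEMeasurable f (volume.restrict (truncNozzle (unitCylinder d) L))) :
    ∫⁻ y in truncNozzle (unitCylinder d) L, f y =
      ∫⁻ y' in Metric.ball (0 : EuclideanSpace ℝ (Fin d)) 1, ∫⁻ s in Ioo (-L) L,
        f (slicePoint y' s) := by
  have hm := (isOpen_truncNozzle (d := d) isOpen_unitCylinder L).measurableSet
  have hpre : (fun q : EuclideanSpace ℝ (Fin d) × ℝ => slicePoint q.1 q.2) ⁻¹'
      (truncNozzle (unitCylinder d) L) = Metric.ball 0 1 ×ˢ Ioo (-L) L := by
    ext ⟨y', s⟩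
    simp only [mem_preimage, truncNozzle, slicePoint_mem_unitCylinder, mem_ofPred_eq,
      slicePoint_last, mem_prod, mem_Ioo, abs_lt]
  have hmp := (measurePreserving_slicePoint (d := d)).restrict_preimage hm
  rw [hpre] at hmp
  rw [← hmp.map_eq, lintegral_map' (by rwa [hmp.map_eq]) hmp.measurable.aemeasurable]
  rw [Measure.volume_eq_prod, setLIntegral_prod]
  rw [← hmp.map_eq] at hf
  exact hf.comp_measurable hmp.measurable

end Slices

/-! ### Change of variables -/

/-- A `C¹` injection with derivative bounded by `K` increases integrals at most by a constant
factor depending on `K` only. -/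
lemma exists_lintegral_image_le {E : Type*} [NormedAddCommGroup E] [NormedSpace ℝ E]
    [FiniteDimensional ℝ E] [MeasurableSpace E] [BorelSpace E] (μ : Measure E)
    [μ.IsAddHaarMeasure] (K : ℝ) :
    ∃ c : ℝ≥0, ∀ (U : Set E) (f : E → E) (f' : E → E →L[ℝ] E), MeasurableSet U →
      (∀ x ∈ U, HasFDerivAt f (f' x) x) → (∀ x ∈ U, ‖f' x‖ ≤ K) → InjOn f U →
      ∀ g : E → ℝ≥0∞, ∫⁻ y in f '' U, g y ∂μ ≤ c * ∫⁻ x in U, g (f x) ∂μ := by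
  -- The determinant is continuous, hence bounded on the compact ball of operators of norm at most
  -- K; this is why the factor depends on K only.
  obtain ⟨C, hC⟩ := (isCompact_closedBall (0 : E →L[ℝ] E) K).exists_bound_of_continuousOn
    (f := fun A => A.det) (ContinuousLinearMap.continuous_det.continuousOn)
  refine ⟨C.toNNReal, fun U f f' hU hf hK hinj g => ?_⟩
  rw [lintegral_image_eq_lintegral_abs_det_fderiv_mul μ hU
    (fun x hx => (hf x hx).hasFDerivWithinAt) hinj, ← lintegral_const_mul' _ _ ENNReal.coe_ne_top]
  refine setLIntegral_mono' hU fun x hx => ?_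
  gcongr
  refine ENNReal.ofReal_le_ofReal ?_
  exact hC _ (by simpa using hK x hx)

/-! ### Slice-preserving diffeomorphisms -/

section SliceDiffeo

variable {d : ℕ}

/-- A `C¹` diffeomorphism with bounded derivative that preserves the last coordinate. -/
structure IsSliceMap (K : ℝ) (U V : Set (EuclideanSpace ℝ (Fin (d + 1))))
    (T S : EuclideanSpace ℝ (Fin (d + 1)) → EuclideanSpace ℝ (Fin (d + 1))) : Prop where
  isOpen : IsOpen U
  mapsTo : MapsTo T U V
  leftInv : ∀ x ∈ U, S (T x) = x
  last_eq : ∀ x ∈ U, T x (Fin.last d) = x (Fin.last d)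
  contDiffOn : ContDiffOn ℝ 1 T U
  bound : ∀ x ∈ U, ‖fderiv ℝ T x‖ ≤ K

/-- The slice condition at height k = xₙ gives both claims at once: interior points stay interior
and keep their height. -/
lemma IsNozzleMap.mapsTo_interior {α K : ℝ} {Ω : Set (EuclideanSpace ℝ (Fin (d + 1)))}
    {T S : EuclideanSpace ℝ (Fin (d + 1)) → EuclideanSpace ℝ (Fin (d + 1))}
    (h : IsNozzleMap α K Ω T S) {x : EuclideanSpace ℝ (Fin (d + 1))} (hx : x ∈ Ω) :
    T x ∈ unitCylinder d ∧ T x (Fin.last d) = x (Fin.last d) := by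
  have : T x ∈ T '' (Ω ∩ {z | z (Fin.last d) = x (Fin.last d)}) := ⟨x, ⟨hx, rfl⟩, rfl⟩
  rw [h.image_slice] at this
  exact this

/-- The slice condition provides a preimage in Ω at the same height, and `S` must return that
preimage because it inverts `T` on the closure. -/
lemma IsNozzleMap.mapsTo_interior_symm {α K : ℝ} {Ω : Set (EuclideanSpace ℝ (Fin (d + 1)))}
    {T S : EuclideanSpace ℝ (Fin (d + 1)) → EuclideanSpace ℝ (Fin (d + 1))}
    (h : IsNozzleMap α K Ω T S) {y : EuclideanSpace ℝ (Fin (d + 1))} (hy : y ∈ unitCylinder d) :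
    S y ∈ Ω ∧ S y (Fin.last d) = y (Fin.last d) := by
  have : y ∈ unitCylinder d ∩ {z | z (Fin.last d) = y (Fin.last d)} := ⟨hy, rfl⟩
  rw [← h.image_slice] at this
  obtain ⟨x, ⟨hx, hxk⟩, rfl⟩ := this
  rw [h.invOn.1 (subset_closure hx)]
  exact ⟨hx, hxk⟩

lemma IsNozzleMap.isSliceMap {α K : ℝ} {Ω : Set (EuclideanSpace ℝ (Fin (d + 1)))}
    {T S : EuclideanSpace ℝ (Fin (d + 1)) → EuclideanSpace ℝ (Fin (d + 1))}
    (h : IsNozzleMap α K Ω T S) (hΩ : IsOpen Ω) : IsSliceMap K Ω (unitCylinder d) T S where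
  isOpen := hΩ
  mapsTo _ hx := (h.mapsTo_interior hx).1
  leftInv _ hx := h.invOn.1 (subset_closure hx)
  last_eq _ hx := (h.mapsTo_interior hx).2
  contDiffOn := h.bound.contDiffOn.of_le (by norm_num)
  bound := h.bound.bound_one

lemma IsNozzleMap.isSliceMap_symm {α K : ℝ} {Ω : Set (EuclideanSpace ℝ (Fin (d + 1)))}
    {T S : EuclideanSpace ℝ (Fin (d + 1)) → EuclideanSpace ℝ (Fin (d + 1))}
    (h : IsNozzleMap α K Ω T S) : IsSliceMap K (unitCylinder d) Ω S T where
  isOpen := isOpen_unitCylinder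
  mapsTo _ hx := (h.mapsTo_interior_symm hx).1
  leftInv _ hx := h.invOn.2 (subset_closure hx)
  last_eq _ hx := (h.mapsTo_interior_symm hx).2
  contDiffOn := h.bound_symm.contDiffOn.of_le (by norm_num)
  bound := h.bound_symm.bound_one

variable {K : ℝ} {U V : Set (EuclideanSpace ℝ (Fin (d + 1)))}
  {T S : EuclideanSpace ℝ (Fin (d + 1)) → EuclideanSpace ℝ (Fin (d + 1))}

lemma IsSliceMap.hasFDerivAt (h : IsSliceMap K U V T S) {x : EuclideanSpace ℝ (Fin (d + 1))}
    (hx : x ∈ U) : HasFDerivAt T (fderiv ℝ T x) x :=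
  ((h.contDiffOn.contDiffAt (h.isOpen.mem_nhds hx)).differentiableAt one_ne_zero).hasFDerivAt

lemma IsSliceMap.injOn (h : IsSliceMap K U V T S) : InjOn T U := fun x hx y hy hxy => by
  rw [← h.leftInv x hx, hxy, h.leftInv y hy]

lemma IsSliceMap.image_truncNozzle (h : IsSliceMap K U V T S) (h' : IsSliceMap K V U S T)
    (L : ℝ) : T '' truncNozzle U L = truncNozzle V L := by
  ext y
  constructor
  · rintro ⟨x, ⟨hx, hxL⟩, rfl⟩
    exact ⟨h.mapsTo hx, by rwa [h.last_eq x hx]⟩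
  · rintro ⟨hy, hyL⟩
    exact ⟨S y, ⟨h'.mapsTo hy, by rwa [h'.last_eq y hy]⟩, h'.leftInv y hy⟩

/-- The map induced on the cross section at height `t`. -/
noncomputable def sliceMap
    (T : EuclideanSpace ℝ (Fin (d + 1)) → EuclideanSpace ℝ (Fin (d + 1))) (t : ℝ)
    (x' : EuclideanSpace ℝ (Fin d)) : EuclideanSpace ℝ (Fin d) :=
  dropLast d (T (slicePoint x' t))

lemma IsSliceMap.slicePoint_sliceMap (h : IsSliceMap K U V T S) {t : ℝ}
    {x' : EuclideanSpace ℝ (Fin d)} (hx : x' ∈ crossSection U t) :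
    slicePoint (sliceMap T t x') t = T (slicePoint x' t) :=
  slicePoint_dropLast_of_eq (by rw [h.last_eq _ hx, slicePoint_last])

lemma IsSliceMap.mapsTo_sliceMap (h : IsSliceMap K U V T S) {t : ℝ}
    {x' : EuclideanSpace ℝ (Fin d)} (hx : x' ∈ crossSection U t) :
    sliceMap T t x' ∈ crossSection V t := by
  change slicePoint _ t ∈ V
  rw [h.slicePoint_sliceMap hx]
  exact h.mapsTo hx

lemma IsSliceMap.sliceMap_sliceMap (h : IsSliceMap K U V T S) {t : ℝ}
    {x' : EuclideanSpace ℝ (Fin d)} (hx : x' ∈ crossSection U t) :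
    sliceMap S t (sliceMap T t x') = x' := by
  rw [sliceMap, h.slicePoint_sliceMap hx, h.leftInv _ hx, dropLast_slicePoint]

lemma IsSliceMap.image_crossSection (h : IsSliceMap K U V T S) (h' : IsSliceMap K V U S T)
    (t : ℝ) : sliceMap T t '' crossSection U t = crossSection V t := by
  ext y
  constructor
  · rintro ⟨x, hx, rfl⟩
    exact h.mapsTo_sliceMap hx
  · intro hy
    exact ⟨sliceMap S t y, h'.mapsTo_sliceMap hy, h'.sliceMap_sliceMap hy⟩

/-- Integrals over truncated domains are comparable under slice-preserving diffeomorphisms. -/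
lemma exists_lintegral_truncNozzle_le (d : ℕ) (K : ℝ) :
    ∃ c : ℝ≥0, ∀ (U V : Set (EuclideanSpace ℝ (Fin (d + 1))))
      (T S : EuclideanSpace ℝ (Fin (d + 1)) → EuclideanSpace ℝ (Fin (d + 1))),
      IsSliceMap K U V T S → IsSliceMap K V U S T →
      ∀ (L : ℝ) (g : EuclideanSpace ℝ (Fin (d + 1)) → ℝ≥0∞),
        ∫⁻ y in truncNozzle V L, g y ≤ c * ∫⁻ x in truncNozzle U L, g (T x) := by
  obtain ⟨c, hc⟩ := exists_lintegral_image_le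
    (volume : Measure (EuclideanSpace ℝ (Fin (d + 1)))) K
  refine ⟨c, fun U V T S h h' L g => ?_⟩
  rw [← h.image_truncNozzle h' L]
  exact hc _ T (fderiv ℝ T) (isOpen_truncNozzle h.isOpen L).measurableSet
    (fun x hx => h.hasFDerivAt hx.1) (fun x hx => h.bound x hx.1)
    (h.injOn.mono fun x hx => hx.1) g

/-- Integrals over cross sections are comparable under slice-preserving diffeomorphisms. -/
lemma exists_lintegral_crossSection_le (d : ℕ) (K : ℝ) :
    ∃ c : ℝ≥0, ∀ (U V : Set (EuclideanSpace ℝ (Fin (d + 1))))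
      (T S : EuclideanSpace ℝ (Fin (d + 1)) → EuclideanSpace ℝ (Fin (d + 1))),
      IsSliceMap K U V T S → IsSliceMap K V U S T →
      ∀ (t : ℝ) (g : EuclideanSpace ℝ (Fin d) → ℝ≥0∞),
        ∫⁻ y in crossSection V t, g y ≤ c * ∫⁻ x in crossSection U t, g (sliceMap T t x) := by
  obtain ⟨c, hc⟩ := exists_lintegral_image_le
    (volume : Measure (EuclideanSpace ℝ (Fin d))) (‖dropLast d‖ * K * ‖zeroSlice d‖)
  refine ⟨c, fun U V T S h h' t g => ?_⟩
  rw [← h.image_crossSection h' t]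
  refine hc _ (sliceMap T t)
    (fun x' => (dropLast d).comp ((fderiv ℝ T (slicePoint x' t)).comp (zeroSlice d)))
    (isOpen_crossSection h.isOpen t).measurableSet (fun x hx => ?_) (fun x hx => ?_) ?_ g
  · have h1 : HasFDerivAt (fun x' : EuclideanSpace ℝ (Fin d) => slicePoint x' t)
        (zeroSlice d) x := by
      simp only [slicePoint_eq]
      exact (zeroSlice d).hasFDerivAt.add_const _
    exact (dropLast d).hasFDerivAt.comp x ((h.hasFDerivAt hx).comp x h1)
  · calc _ ≤ ‖dropLast d‖ * (‖fderiv ℝ T (slicePoint x t)‖ * ‖zeroSlice d‖) :=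
          (ContinuousLinearMap.opNorm_comp_le _ _).trans
            (by gcongr; exact ContinuousLinearMap.opNorm_comp_le _ _)
      _ ≤ ‖dropLast d‖ * (K * ‖zeroSlice d‖) := by gcongr; exact h.bound _ hx
      _ = _ := by ring
  · intro x hx y hy hxy
    rw [← h.sliceMap_sliceMap hx, hxy, h.sliceMap_sliceMap hy]

/-- The truncated nozzle is bounded. -/
lemma IsSliceMap.isBounded_truncNozzle (h : IsSliceMap K (unitCylinder d) V T S)
    (h' : IsSliceMap K V (unitCylinder d) S T) (L : ℝ) :
    Bornology.IsBounded (truncNozzle V L) := by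
  rw [← h.image_truncNozzle h' L]
  -- Convexity of the cylinder turns the derivative bound into a Lipschitz bound.
  have hlip : LipschitzOnWith K.toNNReal T (unitCylinder d) :=
    convex_unitCylinder.lipschitzOnWith_of_nnnorm_hasFDerivWithin_le
      (fun x hx => (h.hasFDerivAt hx).hasFDerivWithinAt)
      (fun x hx => by
        rw [← NNReal.coe_le_coe]
        exact (h.bound x hx).trans (Real.le_coe_toNNReal K))
  have hb : Bornology.IsBounded (truncNozzle (unitCylinder d) L) := by
    refine (Metric.isBounded_closedBall (x := (0 : EuclideanSpace ℝ (Fin (d + 1))))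
      (r := √(1 + L ^ 2))).subset ?_
    rintro x ⟨hx, hxL⟩
    rw [mem_closedBall_zero_iff, EuclideanSpace.norm_eq, Fin.sum_univ_castSucc]
    refine Real.sqrt_le_sqrt (add_le_add ?_ ?_)
    · simpa using (le_of_lt hx)
    · simpa using sq_le_sq' (abs_lt.1 hxL).1.le (abs_lt.1 hxL).2.le
  obtain ⟨C, hC⟩ := Metric.isBounded_iff.1 hb
  refine Metric.isBounded_iff.2 ⟨K.toNNReal * C, ?_⟩
  rintro _ ⟨x, hx, rfl⟩ _ ⟨y, hy, rfl⟩
  exact (hlip.dist_le_mul x hx.1 y hy.1).trans (by gcongr; exact hC hx hy)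

lemma IsSliceMap.isBounded_crossSection (h : IsSliceMap K (unitCylinder d) V T S)
    (h' : IsSliceMap K V (unitCylinder d) S T) (t : ℝ) :
    Bornology.IsBounded (crossSection V t) := by
  -- The half-length |t| + 1 is used since the strict inequality in `truncNozzle` excludes height
  -- |t|.
  refine ((dropLast d).lipschitz.isBounded_image
    (h.isBounded_truncNozzle h' (|t| + 1))).subset fun x' hx => ?_
  exact ⟨slicePoint x' t, ⟨hx, by simp⟩, dropLast_slicePoint x' t⟩

end SliceDiffeo

/-! ### Estimates along the lines of the nozzle -/

lemma ENNReal.add_sq_le_two_mul (a b : ℝ≥0∞) : (a + b) ^ 2 ≤ 2 * (a ^ 2 + b ^ 2) := by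
  have h := ENNReal.rpow_add_le_mul_rpow_add_rpow a b (p := 2) (by norm_num)
  have e : (2 : ℝ) - 1 = 1 := by norm_num
  rw [e, ENNReal.rpow_one] at h
  simpa using h

lemma sq_lintegral_le {α : Type*} [MeasurableSpace α] (μ : Measure α) {g : α → ℝ≥0∞}
    (hg : AEMeasurable g μ) : (∫⁻ a, g a ∂μ) ^ 2 ≤ μ univ * ∫⁻ a, g a ^ 2 ∂μ := by
  have h := ENNReal.lintegral_mul_le_Lp_mul_Lq μ Real.HolderConjugate.two_two
    (f := fun _ => 1) aemeasurable_const hg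
  simp only [Pi.mul_apply, one_mul, ENNReal.rpow_two, one_pow, lintegral_one] at h
  calc _ ≤ (μ univ ^ (1 / 2 : ℝ) * (∫⁻ a, g a ^ 2 ∂μ) ^ (1 / 2 : ℝ)) ^ 2 := by gcongr
    _ = _ := by
      rw [mul_pow, ← ENNReal.rpow_two, ← ENNReal.rpow_two, ← ENNReal.rpow_mul,
        ← ENNReal.rpow_mul]
      norm_num

lemma norm_gradient {E : Type*} [NormedAddCommGroup E] [InnerProductSpace ℝ E] [CompleteSpace E]
    (v : E → ℝ) (x : E) : ‖gradient v x‖ = ‖fderiv ℝ v x‖ := by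
  simp [gradient]

lemma inner_gradient {E : Type*} [NormedAddCommGroup E] [InnerProductSpace ℝ E] [CompleteSpace E]
    (v : E → ℝ) (x w : E) : inner ℝ (gradient v x) w = fderiv ℝ v x w := by
  simp [gradient]

lemma ContDiff.continuous_gradient {E : Type*} [NormedAddCommGroup E] [InnerProductSpace ℝ E]
    [CompleteSpace E] {v : E → ℝ} (hv : ContDiff ℝ 1 v) : Continuous (gradient v) :=
  (InnerProductSpace.toDual ℝ E).symm.continuous.comp (hv.continuous_fderiv one_ne_zero)

section Lines

variable {d : ℕ} {K : ℝ} {V : Set (EuclideanSpace ℝ (Fin (d + 1)))}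
  {T S : EuclideanSpace ℝ (Fin (d + 1)) → EuclideanSpace ℝ (Fin (d + 1))}

lemma continuous_slicePoint_right (y' : EuclideanSpace ℝ (Fin d)) :
    Continuous (slicePoint y') :=
  continuous_slicePoint.comp (Continuous.prodMk_right y')

lemma continuous_slicePoint_left (t : ℝ) :
    Continuous fun y' : EuclideanSpace ℝ (Fin d) => slicePoint y' t :=
  continuous_slicePoint.comp (Continuous.prodMk_left t)

lemma IsSliceMap.continuous_line (h : IsSliceMap K (unitCylinder d) V S T)
    {y' : EuclideanSpace ℝ (Fin d)} (hy : y' ∈ Metric.ball 0 1) :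
    Continuous fun r => S (slicePoint y' r) :=
  h.contDiffOn.continuousOn.comp_continuous (continuous_slicePoint_right y')
    fun _ => slicePoint_mem_unitCylinder.2 hy

lemma IsSliceMap.continuousOn_slice (h : IsSliceMap K (unitCylinder d) V S T) (t : ℝ) :
    ContinuousOn (fun y' => S (slicePoint y' t)) (Metric.ball 0 1) :=
  h.contDiffOn.continuousOn.comp (continuous_slicePoint_left t).continuousOn
    fun _ hy => slicePoint_mem_unitCylinder.2 hy

/-- The fundamental theorem of calculus along a line of the nozzle. -/
lemma IsSliceMap.enorm_line_le (h : IsSliceMap K (unitCylinder d) V S T)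
    {v : EuclideanSpace ℝ (Fin (d + 1)) → ℝ} (hv : ContDiff ℝ 1 v)
    {y' : EuclideanSpace ℝ (Fin d)} (hy : y' ∈ Metric.ball 0 1) {L s t : ℝ}
    (hs : s ∈ Icc (-L) L) (ht : t ∈ Icc (-L) L) :
    ‖v (S (slicePoint y' t))‖ₑ ≤ ‖v (S (slicePoint y' s))‖ₑ +
      ENNReal.ofReal K * ∫⁻ r in Ioo (-L) L, ‖gradient v (S (slicePoint y' r))‖ₑ := by
  have hmem : ∀ r, slicePoint y' r ∈ unitCylinder d := fun r =>
    slicePoint_mem_unitCylinder.2 hy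
  set D : ℝ → ℝ := fun r =>
    fderiv ℝ v (S (slicePoint y' r)) (fderiv ℝ S (slicePoint y' r) (axisVector d)) with hD
  have hderiv : ∀ r, HasDerivAt (fun r => v (S (slicePoint y' r))) (D r) r := by
    intro r
    have h1 : HasDerivAt (fun r => slicePoint y' r) (axisVector d) r := by
      simp only [slicePoint_eq]
      simpa using ((hasDerivAt_id r).smul_const (axisVector d)).const_add (zeroSlice d y')
    have h2 := (h.hasFDerivAt (hmem r)).comp_hasDerivAt r h1
    exact ((hv.differentiable one_ne_zero _).hasFDerivAt).comp_hasDerivAt r h2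
  have hcont : Continuous D := by
    have h1 : Continuous fun r => fderiv ℝ S (slicePoint y' r) :=
      (h.contDiffOn.continuousOn_fderiv_of_isOpen h.isOpen le_rfl).comp_continuous
        (continuous_slicePoint_right y') hmem
    exact ((hv.continuous_fderiv one_ne_zero).comp (h.continuous_line hy)).clm_apply
      (h1.clm_apply continuous_const)
  have hftc : ∫ r in s..t, D r = v (S (slicePoint y' t)) - v (S (slicePoint y' s)) :=
    intervalIntegral.integral_eq_sub_of_hasDerivAt (fun r _ => hderiv r)
      (hcont.intervalIntegrable _ _)
  have hbound : ∀ r, ‖D r‖ₑ ≤ ENNReal.ofReal K * ‖gradient v (S (slicePoint y' r))‖ₑ := by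
    intro r
    have hK := h.bound _ (hmem r)
    rw [← ofReal_norm, ← ofReal_norm, ← ENNReal.ofReal_mul ((norm_nonneg _).trans hK)]
    refine ENNReal.ofReal_le_ofReal ?_
    rw [norm_gradient, mul_comm]
    refine (ContinuousLinearMap.le_opNorm _ _).trans ?_
    gcongr
    refine (ContinuousLinearMap.le_opNorm _ _).trans ?_
    rwa [norm_axisVector, mul_one]
  calc ‖v (S (slicePoint y' t))‖ₑ
      = ‖v (S (slicePoint y' s)) + ∫ r in s..t, D r‖ₑ := by rw [hftc]; congr 1; ring
    _ ≤ ‖v (S (slicePoint y' s))‖ₑ + ‖∫ r in s..t, D r‖ₑ := enorm_add_le _ _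
    _ ≤ _ := by
      gcongr
      rw [← lintegral_const_mul' _ _ ENNReal.ofReal_ne_top]
      calc ‖∫ r in s..t, D r‖ₑ = ‖∫ r in uIoc s t, D r‖ₑ := by
            rw [← ofReal_norm, ← ofReal_norm, intervalIntegral.norm_intervalIntegral_eq]
        _ ≤ ∫⁻ r in uIoc s t, ‖D r‖ₑ := enorm_integral_le_lintegral_enorm _
        _ ≤ ∫⁻ r in Ioc (-L) L, ‖D r‖ₑ :=
            lintegral_mono_set (Ioc_subset_Ioc (le_min hs.1 ht.1) (max_le hs.2 ht.2))
        _ = ∫⁻ r in Ioo (-L) L, ‖D r‖ₑ := by rw [restrict_Ioo_eq_restrict_Ioc]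
        _ ≤ _ := lintegral_mono hbound

/-- Square the line estimate using (a+b)² ≤ 2a² + 2b² and Cauchy–Schwarz on an interval of length
2L. The dependence on L is harmless: this only feeds the trace and Poincaré inequalities at fixed L.
-/
lemma IsSliceMap.enorm_sq_line_le (h : IsSliceMap K (unitCylinder d) V S T)
    {v : EuclideanSpace ℝ (Fin (d + 1)) → ℝ} (hv : ContDiff ℝ 1 v)
    {y' : EuclideanSpace ℝ (Fin d)} (hy : y' ∈ Metric.ball 0 1) {L s t : ℝ}
    (hs : s ∈ Icc (-L) L) (ht : t ∈ Icc (-L) L) :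
    ‖v (S (slicePoint y' t))‖ₑ ^ 2 ≤ 2 * ‖v (S (slicePoint y' s))‖ₑ ^ 2 +
      2 * ENNReal.ofReal K ^ 2 * ENNReal.ofReal (2 * L) *
        ∫⁻ r in Ioo (-L) L, ‖gradient v (S (slicePoint y' r))‖ₑ ^ 2 := by
  have hm : AEMeasurable (fun r => ‖gradient v (S (slicePoint y' r))‖ₑ)
      (volume.restrict (Ioo (-L) L)) :=
    (hv.continuous_gradient.comp (h.continuous_line hy)).enorm.measurable.aemeasurable
  have h2 := sq_lintegral_le _ hm
  rw [Measure.restrict_apply_univ, Real.volume_Ioo] at h2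
  calc _ ≤ (‖v (S (slicePoint y' s))‖ₑ +
      ENNReal.ofReal K * ∫⁻ r in Ioo (-L) L, ‖gradient v (S (slicePoint y' r))‖ₑ) ^ 2 := by
        gcongr; exact h.enorm_line_le hv hy hs ht
    _ ≤ 2 * (‖v (S (slicePoint y' s))‖ₑ ^ 2 +
      (ENNReal.ofReal K * ∫⁻ r in Ioo (-L) L, ‖gradient v (S (slicePoint y' r))‖ₑ) ^ 2) :=
        ENNReal.add_sq_le_two_mul _ _
    _ ≤ 2 * (‖v (S (slicePoint y' s))‖ₑ ^ 2 + ENNReal.ofReal K ^ 2 * (ENNReal.ofReal (L - -L) *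
        ∫⁻ r in Ioo (-L) L, ‖gradient v (S (slicePoint y' r))‖ₑ ^ 2)) := by
        rw [mul_pow]; gcongr
    _ = _ := by rw [show L - -L = 2 * L by ring]; ring

/-- Integrals over the truncated nozzle and its cross sections, in cylindrical coordinates. -/
lemma exists_lintegral_cylindrical (d : ℕ) (K : ℝ) :
    ∃ c : ℝ≥0, ∀ (V : Set (EuclideanSpace ℝ (Fin (d + 1))))
      (T S : EuclideanSpace ℝ (Fin (d + 1)) → EuclideanSpace ℝ (Fin (d + 1))),
      IsSliceMap K (unitCylinder d) V S T → IsSliceMap K V (unitCylinder d) T S →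
      ∀ g : EuclideanSpace ℝ (Fin (d + 1)) → ℝ≥0∞, Continuous g → ∀ t : ℝ,
        (∫⁻ y' in Metric.ball 0 1, ∫⁻ s in Ioo (-t) t, g (S (slicePoint y' s)) ≤
          c * ∫⁻ x in truncNozzle V t, g x) ∧
        (∫⁻ x in truncNozzle V t, g x ≤
          c * ∫⁻ y' in Metric.ball 0 1, ∫⁻ s in Ioo (-t) t, g (S (slicePoint y' s))) ∧
        (∫⁻ y' in Metric.ball 0 1, g (S (slicePoint y' t)) ≤
          c * ∫⁻ x' in crossSection V t, g (slicePoint x' t)) ∧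
        (∫⁻ x' in crossSection V t, g (slicePoint x' t) ≤
          c * ∫⁻ y' in Metric.ball 0 1, g (S (slicePoint y' t))) := by
  obtain ⟨c₁, h₁⟩ := exists_lintegral_truncNozzle_le d K
  obtain ⟨c₂, h₂⟩ := exists_lintegral_crossSection_le d K
  refine ⟨max c₁ c₂, fun V T S h h' g hg t => ?_⟩
  have hc₁ : (c₁ : ℝ≥0∞) ≤ (max c₁ c₂ : ℝ≥0) := by exact_mod_cast le_max_left _ _
  have hc₂ : (c₂ : ℝ≥0∞) ≤ (max c₁ c₂ : ℝ≥0) := by exact_mod_cast le_max_right _ _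
  -- Continuity of g is what makes the pulled-back integrand measurable for Fubini.
  have hfub := lintegral_truncCylinder (d := d) t (f := fun y => g (S y))
    ((hg.comp_continuousOn (h.contDiffOn.continuousOn.mono fun x hx => hx.1)).aemeasurable
      (isOpen_truncNozzle isOpen_unitCylinder t).measurableSet)
  refine ⟨?_, ?_, ?_, ?_⟩
  · rw [← hfub]
    refine (h₁ V (unitCylinder d) T S h' h t _).trans ?_
    rw [setLIntegral_congr_fun (g := g) (isOpen_truncNozzle h'.isOpen t).measurableSet
      fun x hx => by rw [h'.leftInv x hx.1]]
    gcongr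
  · rw [← hfub]
    refine (h₁ (unitCylinder d) V S T h h' t _).trans ?_
    gcongr
  · have := h₂ V (unitCylinder d) T S h' h t (fun y' => g (S (slicePoint y' t)))
    rw [crossSection_unitCylinder] at this
    refine this.trans ?_
    rw [setLIntegral_congr_fun (g := fun x' => g (slicePoint x' t))
      (isOpen_crossSection h'.isOpen t).measurableSet
      fun x hx => by rw [h'.slicePoint_sliceMap hx, h'.leftInv _ hx]]
    gcongr
  · have := h₂ (unitCylinder d) V S T h h' t (fun x' => g (slicePoint x' t))
    refine this.trans ?_
    rw [setLIntegral_congr_fun (g := fun y' => g (S (slicePoint y' t)))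
      (isOpen_crossSection h.isOpen t).measurableSet
      fun x hx => by rw [h.slicePoint_sliceMap hx], crossSection_unitCylinder]
    gcongr

/-- Trace inequality at the outlet. -/
lemma IsSliceMap.exists_trace_le (h : IsSliceMap K (unitCylinder d) V S T)
    (h' : IsSliceMap K V (unitCylinder d) T S) {L : ℝ} (hL : 0 < L) :
    ∃ A : ℝ≥0, ∀ v : EuclideanSpace ℝ (Fin (d + 1)) → ℝ, ContDiff ℝ 1 v →
      ∫⁻ x' in crossSection V L, ‖v (slicePoint x' L)‖ₑ ^ 2 ≤
        A * ((∫⁻ x in truncNozzle V L, ‖v x‖ₑ ^ 2) +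
          ∫⁻ x in truncNozzle V L, ‖gradient v x‖ₑ ^ 2) := by
  obtain ⟨c, hc⟩ := exists_lintegral_cylindrical d K
  -- M is the sum of the two coefficients obtained by integrating the line estimate over s, so it
  -- dominates each.
  set M : ℝ≥0 := 2 + 2 * K.toNNReal ^ 2 * (2 * L).toNNReal * (2 * L).toNNReal with hM
  refine ⟨c * ((2 * L).toNNReal⁻¹ * (c * M)), fun v hv => ?_⟩
  set G : EuclideanSpace ℝ (Fin (d + 1)) → ℝ≥0∞ := fun x => ‖v x‖ₑ ^ 2 + ‖gradient v x‖ₑ ^ 2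
  have hvc : Continuous fun x => ‖v x‖ₑ ^ 2 := (ENNReal.continuous_pow 2).comp hv.continuous.enorm
  have hgc : Continuous fun x => ‖gradient v x‖ₑ ^ 2 :=
    (ENNReal.continuous_pow 2).comp hv.continuous_gradient.enorm
  have hG : Continuous G := hvc.add hgc
  have hL2 : (2 * L).toNNReal ≠ 0 := by simp [hL]
  have hline : ∀ y' ∈ Metric.ball (0 : EuclideanSpace ℝ (Fin d)) 1,
      ‖v (S (slicePoint y' L))‖ₑ ^ 2 ≤ ((2 * L).toNNReal⁻¹ * M : ℝ≥0) *
        ∫⁻ s in Ioo (-L) L, G (S (slicePoint y' s)) := by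
    intro y' hy
    set I := ∫⁻ r in Ioo (-L) L, ‖gradient v (S (slicePoint y' r))‖ₑ ^ 2
    have hI : ∫⁻ s in Ioo (-L) L, G (S (slicePoint y' s)) =
        (∫⁻ s in Ioo (-L) L, ‖v (S (slicePoint y' s))‖ₑ ^ 2) + I :=
      lintegral_add_left (f := fun s => ‖v (S (slicePoint y' s))‖ₑ ^ 2)
        (hvc.comp (h.continuous_line hy)).measurable _
    -- Average over the starting height s: the left side is constant in s, so integration over (−L,
    -- L) multiplies it by 2L.
    have h1 : ((2 * L).toNNReal : ℝ≥0∞) * ‖v (S (slicePoint y' L))‖ₑ ^ 2 ≤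
        M * ∫⁻ s in Ioo (-L) L, G (S (slicePoint y' s)) := by
      calc ((2 * L).toNNReal : ℝ≥0∞) * ‖v (S (slicePoint y' L))‖ₑ ^ 2
          = ∫⁻ s in Ioo (-L) L, ‖v (S (slicePoint y' L))‖ₑ ^ 2 := by
            rw [setLIntegral_const, Real.volume_Ioo, mul_comm, show L - -L = 2 * L by ring]
            rfl
        _ ≤ ∫⁻ s in Ioo (-L) L, (2 * ‖v (S (slicePoint y' s))‖ₑ ^ 2 +
              2 * ENNReal.ofReal K ^ 2 * ENNReal.ofReal (2 * L) * I) :=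
            setLIntegral_mono' measurableSet_Ioo fun s hs =>
              h.enorm_sq_line_le hv hy ⟨hs.1.le, hs.2.le⟩ ⟨by linarith, le_rfl⟩
        _ = 2 * (∫⁻ s in Ioo (-L) L, ‖v (S (slicePoint y' s))‖ₑ ^ 2) +
              2 * ENNReal.ofReal K ^ 2 * ENNReal.ofReal (2 * L) * ENNReal.ofReal (2 * L) * I := by
            rw [lintegral_add_right _ measurable_const, lintegral_const_mul' _ _ (by simp),
              setLIntegral_const, Real.volume_Ioo, show L - -L = 2 * L by ring]
            ring
        _ ≤ M * (∫⁻ s in Ioo (-L) L, ‖v (S (slicePoint y' s))‖ₑ ^ 2) + M * I := by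
            rw [hM]
            push_cast
            gcongr
            · exact le_self_add
            · exact le_add_self
        _ = _ := by rw [hI, mul_add]
    calc ‖v (S (slicePoint y' L))‖ₑ ^ 2
        = ((2 * L).toNNReal⁻¹ * (2 * L).toNNReal : ℝ≥0) * ‖v (S (slicePoint y' L))‖ₑ ^ 2 := by
          rw [inv_mul_cancel₀ hL2]; simp
      _ ≤ _ := by
          rw [ENNReal.coe_mul, ENNReal.coe_mul, mul_assoc, mul_assoc]
          gcongr
  calc _ ≤ (c : ℝ≥0∞) * ∫⁻ y' in Metric.ball 0 1, ‖v (S (slicePoint y' L))‖ₑ ^ 2 :=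
        (hc V T S h h' _ hvc L).2.2.2
    _ ≤ c * ∫⁻ y' in Metric.ball 0 1, (((2 * L).toNNReal⁻¹ * M : ℝ≥0) *
        ∫⁻ s in Ioo (-L) L, G (S (slicePoint y' s))) := by
        gcongr 1
        exact setLIntegral_mono' measurableSet_ball hline
    _ = c * (((2 * L).toNNReal⁻¹ * M : ℝ≥0) * ∫⁻ y' in Metric.ball 0 1,
        ∫⁻ s in Ioo (-L) L, G (S (slicePoint y' s))) := by
        rw [lintegral_const_mul' _ _ ENNReal.coe_ne_top]
    _ ≤ c * (((2 * L).toNNReal⁻¹ * M : ℝ≥0) * (c * ∫⁻ x in truncNozzle V L, G x)) := by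
        gcongr
        exact (hc V T S h h' G hG L).1
    _ = _ := by
        rw [lintegral_add_left hvc.measurable]
        push_cast
        ring

/-- Poincaré inequality in terms of the values at the inlet. -/
lemma IsSliceMap.exists_poincare_le (h : IsSliceMap K (unitCylinder d) V S T)
    (h' : IsSliceMap K V (unitCylinder d) T S) {L : ℝ} (hL : 0 < L) :
    ∃ A : ℝ≥0, ∀ v : EuclideanSpace ℝ (Fin (d + 1)) → ℝ, ContDiff ℝ 1 v →
      ∫⁻ x in truncNozzle V L, ‖v x‖ₑ ^ 2 ≤
        A * ((∫⁻ x' in crossSection V (-L), ‖v (slicePoint x' (-L))‖ₑ ^ 2) +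
          ∫⁻ x in truncNozzle V L, ‖gradient v x‖ₑ ^ 2) := by
  obtain ⟨c, hc⟩ := exists_lintegral_cylindrical d K
  set l : ℝ≥0 := (2 * L).toNNReal with hl
  set M : ℝ≥0 := 2 + 2 * K.toNNReal ^ 2 * l with hM
  refine ⟨c * l * M * c, fun v hv => ?_⟩
  have hvc : Continuous fun x => ‖v x‖ₑ ^ 2 := (ENNReal.continuous_pow 2).comp hv.continuous.enorm
  have hgc : Continuous fun x => ‖gradient v x‖ₑ ^ 2 :=
    (ENNReal.continuous_pow 2).comp hv.continuous_gradient.enorm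
  have hline : ∀ y' ∈ Metric.ball (0 : EuclideanSpace ℝ (Fin d)) 1,
      ∫⁻ s in Ioo (-L) L, ‖v (S (slicePoint y' s))‖ₑ ^ 2 ≤ (l * M : ℝ≥0) *
        (‖v (S (slicePoint y' (-L)))‖ₑ ^ 2 +
          ∫⁻ r in Ioo (-L) L, ‖gradient v (S (slicePoint y' r))‖ₑ ^ 2) := by
    intro y' hy
    set I := ∫⁻ r in Ioo (-L) L, ‖gradient v (S (slicePoint y' r))‖ₑ ^ 2
    -- Here the line starts at the inlet, and it is the end point s that is integrated.
    calc _ ≤ ∫⁻ s in Ioo (-L) L, (2 * ‖v (S (slicePoint y' (-L)))‖ₑ ^ 2 +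
              2 * ENNReal.ofReal K ^ 2 * ENNReal.ofReal (2 * L) * I) :=
            setLIntegral_mono' measurableSet_Ioo fun s hs =>
              h.enorm_sq_line_le hv hy ⟨le_rfl, by linarith⟩ ⟨hs.1.le, hs.2.le⟩
      _ = l * (2 * ‖v (S (slicePoint y' (-L)))‖ₑ ^ 2 + 2 * (K.toNNReal : ℝ≥0∞) ^ 2 * l * I) := by
            rw [setLIntegral_const, Real.volume_Ioo, show L - -L = 2 * L by ring, mul_comm]
            rfl
      _ ≤ l * (M * ‖v (S (slicePoint y' (-L)))‖ₑ ^ 2 + M * I) := by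
            rw [hM]
            push_cast
            gcongr
            · exact le_self_add
            · exact le_add_self
      _ = _ := by push_cast; ring
  calc _ ≤ (c : ℝ≥0∞) * ∫⁻ y' in Metric.ball 0 1,
        ∫⁻ s in Ioo (-L) L, ‖v (S (slicePoint y' s))‖ₑ ^ 2 := (hc V T S h h' _ hvc L).2.1
    _ ≤ c * ∫⁻ y' in Metric.ball 0 1, ((l * M : ℝ≥0) * (‖v (S (slicePoint y' (-L)))‖ₑ ^ 2 +
          ∫⁻ r in Ioo (-L) L, ‖gradient v (S (slicePoint y' r))‖ₑ ^ 2)) := by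
        gcongr 1
        exact setLIntegral_mono' measurableSet_ball hline
    _ = c * ((l * M : ℝ≥0) * ((∫⁻ y' in Metric.ball 0 1, ‖v (S (slicePoint y' (-L)))‖ₑ ^ 2) +
          ∫⁻ y' in Metric.ball 0 1,
            ∫⁻ r in Ioo (-L) L, ‖gradient v (S (slicePoint y' r))‖ₑ ^ 2)) := by
        rw [lintegral_const_mul' _ _ ENNReal.coe_ne_top, lintegral_add_left']
        exact (hvc.comp_continuousOn (h.continuousOn_slice (-L))).aemeasurable measurableSet_ball
    _ ≤ c * ((l * M : ℝ≥0) *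
        (c * (∫⁻ x' in crossSection V (-L), ‖v (slicePoint x' (-L))‖ₑ ^ 2) +
          c * ∫⁻ x in truncNozzle V L, ‖gradient v x‖ₑ ^ 2)) := by
        gcongr
        · exact (hc V T S h h' _ hvc (-L)).2.2.1
        · exact (hc V T S h h' _ hgc L).1
    _ = _ := by push_cast; ring

/-- The values at the outlet are controlled in `L¹` with a constant independent of the length. -/
lemma exists_flux_le (d : ℕ) (K : ℝ) :
    ∃ c : ℝ≥0, ∀ (V : Set (EuclideanSpace ℝ (Fin (d + 1))))
      (T S : EuclideanSpace ℝ (Fin (d + 1)) → EuclideanSpace ℝ (Fin (d + 1))),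
      IsSliceMap K (unitCylinder d) V S T → IsSliceMap K V (unitCylinder d) T S →
      ∀ L : ℝ, 0 < L → ∀ v : EuclideanSpace ℝ (Fin (d + 1)) → ℝ, ContDiff ℝ 1 v →
      ∫⁻ x' in crossSection V L, ‖v (slicePoint x' L)‖ₑ ≤
        c * ((∫⁻ x' in crossSection V (-L), ‖v (slicePoint x' (-L))‖ₑ) +
          ∫⁻ x in truncNozzle V L, ‖gradient v x‖ₑ) := by
  obtain ⟨c, hc⟩ := exists_lintegral_cylindrical d K
  refine ⟨c * (1 + K.toNNReal) * c, fun V T S h h' L hL v hv => ?_⟩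
  have hvc : Continuous fun x => ‖v x‖ₑ := hv.continuous.enorm
  have hgc : Continuous fun x => ‖gradient v x‖ₑ := hv.continuous_gradient.enorm
  calc _ ≤ (c : ℝ≥0∞) * ∫⁻ y' in Metric.ball 0 1, ‖v (S (slicePoint y' L))‖ₑ :=
        (hc V T S h h' _ hvc L).2.2.2
    -- The first-power line estimate has no factor L, in contrast with its squared version; this
    -- makes the constant independent of the length.
    _ ≤ c * ∫⁻ y' in Metric.ball 0 1, (‖v (S (slicePoint y' (-L)))‖ₑ +
          ENNReal.ofReal K * ∫⁻ r in Ioo (-L) L, ‖gradient v (S (slicePoint y' r))‖ₑ) := by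
        gcongr 1
        exact setLIntegral_mono' measurableSet_ball fun y' hy =>
          h.enorm_line_le hv hy ⟨le_rfl, by linarith⟩ ⟨by linarith, le_rfl⟩
    _ = c * ((∫⁻ y' in Metric.ball 0 1, ‖v (S (slicePoint y' (-L)))‖ₑ) + (K.toNNReal : ℝ≥0∞) *
          ∫⁻ y' in Metric.ball 0 1,
            ∫⁻ r in Ioo (-L) L, ‖gradient v (S (slicePoint y' r))‖ₑ) := by
        rw [lintegral_add_left', lintegral_const_mul' _ _ ENNReal.ofReal_ne_top]
        · rfl
        exact (hvc.comp_continuousOn (h.continuousOn_slice (-L))).aemeasurable measurableSet_ball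
    _ ≤ c * ((1 + K.toNNReal : ℝ≥0) * (c * ∫⁻ x' in crossSection V (-L), ‖v (slicePoint x' (-L))‖ₑ) +
          (1 + K.toNNReal : ℝ≥0) * (c * ∫⁻ x in truncNozzle V L, ‖gradient v x‖ₑ)) := by
        refine mul_le_mul_right (add_le_add ?_ (mul_le_mul' ?_ ?_)) _
        · refine ((hc V T S h h' _ hvc (-L)).2.2.1).trans (le_mul_of_one_le_left' ?_)
          exact_mod_cast le_self_add
        · exact_mod_cast le_add_self
        · exact (hc V T S h h' _ hgc L).1
    _ = _ := by push_cast; ring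

/-- The cross sections have areas bounded below. -/
lemma exists_le_volume_crossSection (d : ℕ) (K : ℝ) :
    ∃ c : ℝ≥0, ∀ (V : Set (EuclideanSpace ℝ (Fin (d + 1))))
      (T S : EuclideanSpace ℝ (Fin (d + 1)) → EuclideanSpace ℝ (Fin (d + 1))),
      IsSliceMap K (unitCylinder d) V S T → IsSliceMap K V (unitCylinder d) T S →
      ∀ t : ℝ, volume (Metric.ball (0 : EuclideanSpace ℝ (Fin d)) 1) ≤
        c * volume (crossSection V t) := by
  obtain ⟨c, hc⟩ := exists_lintegral_cylindrical d K
  refine ⟨c, fun V T S h h' t => ?_⟩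
  simpa using (hc V T S h h' (fun _ => 1) continuous_const t).2.2.1

end Lines

/-! ### The gas and the energy density -/

section Gas

variable {p ρ Θ : ℝ → ℝ} {δ : ℝ}

lemma IsPressureLaw.continuousOn_deriv (hp : IsPressureLaw p) : ContinuousOn (deriv p) (Ioi 0) :=
  (hp.smooth.continuousOn_deriv_of_isOpen isOpen_Ioi (by simp))

lemma IsPressureLaw.strictMonoOn_deriv (hp : IsPressureLaw p) :
    StrictMonoOn (deriv p) (Ioi 0) := by
  refine strictMonoOn_of_deriv_pos (convex_Ioi 0) hp.continuousOn_deriv fun r hr => ?_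
  rw [interior_Ioi] at hr
  exact hp.deriv_two_pos r hr

lemma IsPressureLaw.hasDerivAt_enthalpy (hp : IsPressureLaw p) {r : ℝ} (hr : 0 < r) :
    HasDerivAt (enthalpy p) (deriv p r / r) r := by
  have hc : ContinuousOn (fun s => deriv p s / s) (Ioi 0) :=
    hp.continuousOn_deriv.div continuousOn_id fun s hs => (ne_of_gt hs)
  have hsub : uIcc 1 r ⊆ Ioi 0 := fun s hs => lt_of_lt_of_le (lt_min one_pos hr) hs.1
  exact intervalIntegral.integral_hasDerivAt_right ((hc.mono hsub).intervalIntegrable)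
    (hc.stronglyMeasurableAtFilter isOpen_Ioi r hr) (hc.continuousAt (Ioi_mem_nhds hr))

lemma IsPressureLaw.strictMonoOn_enthalpy (hp : IsPressureLaw p) :
    StrictMonoOn (enthalpy p) (Ioi 0) := by
  refine strictMonoOn_of_deriv_pos (convex_Ioi 0)
    (fun r hr => (hp.hasDerivAt_enthalpy hr).continuousAt.continuousWithinAt) fun r hr => ?_
  rw [interior_Ioi] at hr
  rw [(hp.hasDerivAt_enthalpy hr).deriv]
  exact div_pos (hp.deriv_pos r hr) hr

/-- At subsonic speed Bernoulli's law makes the enthalpy positive, and enthalpy increases from the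
value 0 at density 1. -/
lemma IsDensitySpeedRelation.one_lt (hp : IsPressureLaw p) (hρ : IsDensitySpeedRelation p ρ)
    {s : ℝ} (h0 : 0 ≤ s) (h1 : s < 1) : 1 < ρ s := by
  obtain ⟨hpos, hB⟩ := hρ s ⟨h0, h1.le⟩
  by_contra! hle
  have := hp.strictMonoOn_enthalpy.monotoneOn (mem_Ioi.2 hpos) (mem_Ioi.2 one_pos) hle
  rw [show enthalpy p 1 = 0 by simp [enthalpy]] at this
  linarith

lemma IsSubsonicTruncation.hasDerivAt (hΘ : IsSubsonicTruncation ρ δ Θ) {s : ℝ} (hs : 0 < s) :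
    HasDerivAt Θ (deriv Θ s) s :=
  ((hΘ.smooth.contDiffAt (Ici_mem_nhds hs)).differentiableAt (by simp)).hasDerivAt

/-- Ellipticity of the truncated equation. -/
lemma IsSubsonicTruncation.elliptic_pos (hp : IsPressureLaw p) (hρ : IsDensitySpeedRelation p ρ)
    (hΘ : IsSubsonicTruncation ρ δ Θ) {s : ℝ} (hs : 0 < s) (hs' : s ≤ 1 - δ) :
    0 < Θ s + 2 * s * deriv Θ s := by
  obtain ⟨hδ0, hδ⟩ := hΘ.delta_mem
  rcases le_or_gt (1 - 2 * δ) s with h | h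
  · exact hΘ.elliptic s ⟨h, hs'⟩
  have hs1 : s < 1 := by linarith
  have hΘs := hΘ.eq_density s hs.le h
  have hone : 1 < Θ s := hΘs ▸ hρ.one_lt hp hs.le hs1
  have hpos : 0 < Θ s := by linarith
  have hd : HasDerivAt (fun s => s / 2 + enthalpy p (Θ s))
      (1 / 2 + deriv p (Θ s) / Θ s * deriv Θ s) s :=
    ((hasDerivAt_id s).div_const 2).add
      ((hp.hasDerivAt_enthalpy hpos).comp s (hΘ.hasDerivAt hs))
  have hconst : (fun s => s / 2 + enthalpy p (Θ s)) =ᶠ[𝓝 s] fun _ => 1 / 2 := by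
    filter_upwards [Ioo_mem_nhds hs h] with r hr
    rw [hΘ.eq_density r hr.1.le hr.2]
    exact (hρ r ⟨hr.1.le, by linarith [hr.2]⟩).2
  -- Bernoulli's law is constant in s; its derivative gives 2p'(Θ)Θ' = −Θ.
  have h0 := hd.unique ((hasDerivAt_const s (1 / 2 : ℝ)).congr_of_eventuallyEq hconst)
  have hp1 : 1 < deriv p (Θ s) := by
    rw [← hp.critical]
    exact hp.strictMonoOn_deriv (mem_Ioi.2 one_pos) (mem_Ioi.2 hpos) hone
  have hmul : deriv p (Θ s) * (2 * deriv Θ s) = -Θ s := by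
    field_simp at h0
    linarith
  -- By the differentiated law this product is Θ(p'(Θ) − s), and p'(Θ) > 1 > s: the flow is slower
  -- than sound.
  have : 0 < deriv p (Θ s) * (Θ s + 2 * s * deriv Θ s) := by
    calc 0 < Θ s * (deriv p (Θ s) - s) := mul_pos hpos (by linarith)
      _ = _ := by linear_combination -s * hmul
  exact (pos_iff_pos_of_mul_pos this).1 (by linarith)

/-- The quantitative consequences of the truncation: uniform ellipticity. -/
structure IsElliptic (lam Lam : ℝ) (Θ : ℝ → ℝ) : Prop where
  lam_pos : 0 < lam
  continuousOn : ContinuousOn Θ (Ici 0)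
  le_upper : ∀ s, 0 ≤ s → |Θ s| ≤ Lam
  monotone : MonotoneOn (fun r => Θ (r ^ 2) * r - lam * r) (Ici 0)

/-- On the compact interval [0, 1−δ] the eigenvalue Θ + 2sΘ' is continuous and positive, so it has a
positive minimum; beyond, it equals ρ(1−δ). With s = r² it is the derivative of rΘ(r²), which gives
the monotonicity. -/
lemma IsSubsonicTruncation.exists_isElliptic (hp : IsPressureLaw p)
    (hρ : IsDensitySpeedRelation p ρ) (hΘ : IsSubsonicTruncation ρ δ Θ) :
    ∃ lam Lam : ℝ, IsElliptic lam Lam Θ := by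
  obtain ⟨hδ0, hδ⟩ := hΘ.delta_mem
  have hρδ : 0 < ρ (1 - δ) := (hρ _ ⟨by linarith, by linarith⟩).1
  have hcont := hΘ.smooth.continuousOn
  -- Smoothness holds only on [0,∞), so the one-sided derivative is the one that is continuous up to
  -- s = 0.
  have hdc : ContinuousOn (derivWithin Θ (Ici 0)) (Ici 0) :=
    hΘ.smooth.continuousOn_derivWithin (uniqueDiffOn_Ici 0) (by simp)
  have hdw : ∀ s, 0 < s → derivWithin Θ (Ici 0) s = deriv Θ s := fun s hs =>
    derivWithin_of_mem_nhds (Ici_mem_nhds hs)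
  obtain ⟨s₀, hs₀, hmin⟩ := isCompact_Icc.exists_isMinOn
    (nonempty_Icc.2 (by linarith : (0 : ℝ) ≤ 1 - δ))
    (f := fun s => Θ s + 2 * s * derivWithin Θ (Ici 0) s)
    ((hcont.add ((continuousOn_const.mul continuousOn_id).mul hdc)).mono Icc_subset_Ici_self)
  have hlow : ∀ s, 0 ≤ s → 0 < Θ s := by
    intro s hs
    -- The shift by 1 moves any s ≥ 0 past 1 − δ, where Θ is constant.
    calc 0 < Θ (s + 1) := by rw [hΘ.eq_const _ (by linarith)]; exact hρδ
      _ ≤ Θ s := hΘ.antitone hs (mem_Ici.2 (by linarith)) (by linarith)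
  have hpos : 0 < Θ s₀ + 2 * s₀ * derivWithin Θ (Ici 0) s₀ := by
    rcases hs₀.1.eq_or_lt with h | h
    · rw [← h]; simpa using hlow 0 le_rfl
    · rw [hdw _ h]; exact hΘ.elliptic_pos hp hρ h hs₀.2
  set lam := min (Θ s₀ + 2 * s₀ * derivWithin Θ (Ici 0) s₀) (ρ (1 - δ)) with hlam
  have hell : ∀ s, 0 < s → lam ≤ Θ s + 2 * s * deriv Θ s := by
    intro s hs
    rcases le_or_gt s (1 - δ) with h | h
    · rw [← hdw s hs]
      exact (min_le_left _ _).trans (isMinOn_iff.1 hmin s ⟨hs.le, h⟩)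
    · have : deriv Θ s = 0 := by
        have : Θ =ᶠ[𝓝 s] fun _ => ρ (1 - δ) := by
          filter_upwards [Ioi_mem_nhds h] with r hr using hΘ.eq_const r hr
        rw [this.deriv_eq, deriv_const]
      rw [this, hΘ.eq_const s h]
      rw [mul_zero, add_zero]
      exact min_le_right _ _
  refine ⟨lam, Θ 0, lt_min hpos hρδ, hcont, fun s hs => ?_, ?_⟩
  · rw [abs_of_pos (hlow s hs)]
    exact hΘ.antitone (mem_Ici.2 le_rfl) hs hs
  · refine monotoneOn_of_hasDerivWithinAt_nonneg (convex_Ici 0) (f' := fun r =>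
      Θ (r ^ 2) + 2 * r ^ 2 * deriv Θ (r ^ 2) - lam) ?_ ?_ ?_
    · refine ContinuousOn.sub (ContinuousOn.mul ?_ continuousOn_id) (by fun_prop)
      exact hcont.comp (by fun_prop) fun r _ => mem_Ici.2 (sq_nonneg r)
    · intro r hr
      rw [interior_Ici] at hr
      have h1 := HasDerivAt.comp (h := fun r => r ^ 2) r (hΘ.hasDerivAt (pow_pos hr 2))
        (hasDerivAt_pow 2 r)
      have h2 := (h1.mul (hasDerivAt_id r)).sub ((hasDerivAt_id r).const_mul lam)
      refine (h2.congr_deriv ?_).hasDerivWithinAt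
      simp
      ring
    · intro r hr
      rw [interior_Ici] at hr
      exact sub_nonneg.2 (hell _ (pow_pos hr 2))

variable {lam Lam : ℝ}

lemma IsElliptic.intervalIntegrable (h : IsElliptic lam Lam Θ) {a b : ℝ} (ha : 0 ≤ a)
    (hb : 0 ≤ b) : IntervalIntegrable Θ volume a b :=
  (h.continuousOn.mono fun _ hs => mem_Ici.2 ((le_min ha hb).trans hs.1)).intervalIntegrable

/-- The derivative Θ/2 of F is bounded by Lam/2. -/
lemma IsElliptic.abs_energyDensity_sub_le (h : IsElliptic lam Lam Θ) {a b : ℝ} (ha : 0 ≤ a)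
    (hb : 0 ≤ b) : |energyDensity Θ a - energyDensity Θ b| ≤ Lam / 2 * |a - b| := by
  have h1 : energyDensity Θ a - energyDensity Θ b = 1 / 2 * ∫ s in b..a, Θ s := by
    rw [energyDensity, energyDensity, ← mul_sub, intervalIntegral.integral_interval_sub_left
      (h.intervalIntegrable le_rfl ha) (h.intervalIntegrable le_rfl hb)]
  have h2 : ‖∫ s in b..a, Θ s‖ ≤ Lam * |a - b| :=
    intervalIntegral.norm_integral_le_of_norm_le_const fun s hs =>
      h.le_upper s ((le_min hb ha).trans (uIoc_subset_uIcc hs).1)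
  rw [Real.norm_eq_abs] at h2
  rw [h1, abs_mul, abs_of_pos (by norm_num : (0 : ℝ) < 1 / 2)]
  linarith

/-- The factor ½ in F cancels the 2 from r², so the derivative is exactly the function in
`IsElliptic.monotone`. -/
lemma IsElliptic.hasDerivAt_energyDensity_sq (h : IsElliptic lam Lam Θ) {r : ℝ} (hr : 0 < r) :
    HasDerivAt (fun r => energyDensity Θ (r ^ 2) - lam / 2 * r ^ 2)
      (Θ (r ^ 2) * r - lam * r) r := by
  have hr2 : 0 < r ^ 2 := pow_pos hr 2
  have h1 : HasDerivAt (energyDensity Θ) (1 / 2 * Θ (r ^ 2)) (r ^ 2) :=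
    (intervalIntegral.integral_hasDerivAt_right (h.intervalIntegrable le_rfl hr2.le)
      ((h.continuousOn.mono Ioi_subset_Ici_self).stronglyMeasurableAtFilter isOpen_Ioi _ hr2)
      (h.continuousOn.continuousAt (Ici_mem_nhds hr2))).const_mul (1 / 2)
  have h2 := (HasDerivAt.comp (h := fun r => r ^ 2) r h1 (hasDerivAt_pow 2 r)).sub
    ((hasDerivAt_pow 2 r).const_mul (lam / 2))
  refine h2.congr_deriv ?_
  simp
  ring

lemma IsElliptic.continuousOn_energyDensity (h : IsElliptic lam Lam Θ) :
    ContinuousOn (energyDensity Θ) (Ici 0) := by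
  refine (LipschitzOnWith.of_dist_le_mul (K := (Lam / 2).toNNReal) fun a ha b hb => ?_).continuousOn
  rw [Real.dist_eq, Real.dist_eq]
  exact (h.abs_energyDensity_sub_le ha hb).trans
    (by gcongr; exact Real.le_coe_toNNReal _)

lemma IsElliptic.continuous_energyDensity_norm_sq (h : IsElliptic lam Lam Θ) {E : Type*}
    [NormedAddCommGroup E] : Continuous fun x : E => energyDensity Θ (‖x‖ ^ 2) :=
  h.continuousOn_energyDensity.comp_continuous (by fun_prop) fun _ => mem_Ici.2 (sq_nonneg _)

/-- The derivative is nondecreasing and vanishes at 0, hence is nonnegative. -/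
lemma IsElliptic.monotoneOn_excess (h : IsElliptic lam Lam Θ) :
    MonotoneOn (fun r => energyDensity Θ (r ^ 2) - lam / 2 * r ^ 2) (Ici 0) := by
  refine monotoneOn_of_hasDerivWithinAt_nonneg (convex_Ici 0) (f' := fun r =>
      Θ (r ^ 2) * r - lam * r) ?_ ?_ ?_
  · exact ((h.continuousOn_energyDensity.comp (by fun_prop) fun r _ =>
      mem_Ici.2 (sq_nonneg r))).sub (by fun_prop)
  · intro r hr
    rw [interior_Ici] at hr
    exact (h.hasDerivAt_energyDensity_sq hr).hasDerivWithinAt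
  · intro r hr
    rw [interior_Ici] at hr
    simpa using h.monotone (mem_Ici.2 le_rfl) (mem_Ici.2 (le_of_lt hr)) (le_of_lt hr)

lemma IsElliptic.convexOn_excess (h : IsElliptic lam Lam Θ) :
    ConvexOn ℝ (Ici 0) (fun r => energyDensity Θ (r ^ 2) - lam / 2 * r ^ 2) := by
  refine MonotoneOn.convexOn_of_deriv (convex_Ici 0) ?_ ?_ ?_
  · exact ((h.continuousOn_energyDensity.comp (by fun_prop) fun r _ =>
      mem_Ici.2 (sq_nonneg r))).sub (by fun_prop)
  · rw [interior_Ici]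
    exact fun r hr => (h.hasDerivAt_energyDensity_sq hr).differentiableAt.differentiableWithinAt
  · rw [interior_Ici]
    refine (h.monotone.mono Ioi_subset_Ici_self).congr fun r hr => ?_
    exact (h.hasDerivAt_energyDensity_sq hr).deriv.symm

lemma energyDensity_zero (Θ : ℝ → ℝ) : energyDensity Θ 0 = 0 := by simp [energyDensity]

/-- Coercivity: the excess over the quadratic part is nondecreasing from its value 0 at r = 0. -/
lemma IsElliptic.le_energyDensity (h : IsElliptic lam Lam Θ) {r : ℝ} (hr : 0 ≤ r) :
    lam / 2 * r ^ 2 ≤ energyDensity Θ (r ^ 2) := by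
  have := h.monotoneOn_excess (mem_Ici.2 le_rfl) (mem_Ici.2 hr) hr
  simp only [ne_eq, OfNat.ofNat_ne_zero, not_false_eq_true, zero_pow, energyDensity_zero] at this
  linarith

lemma IsElliptic.energyDensity_mono (h : IsElliptic lam Lam Θ) {r s : ℝ} (hr : 0 ≤ r)
    (hrs : r ≤ s) : energyDensity Θ (r ^ 2) ≤ energyDensity Θ (s ^ 2) := by
  have h1 := h.monotoneOn_excess (mem_Ici.2 hr) (mem_Ici.2 (hr.trans hrs)) hrs
  have h2 : lam / 2 * r ^ 2 ≤ lam / 2 * s ^ 2 := by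
    have := h.lam_pos
    gcongr
  simp only at h1
  linarith

/-- Strong convexity of `v ↦ F(|v|²)`. -/
lemma IsElliptic.energyDensity_midpoint_le (h : IsElliptic lam Lam Θ) {E : Type*}
    [NormedAddCommGroup E] [InnerProductSpace ℝ E] (x y : E) :
    energyDensity Θ (‖(1 / 2 : ℝ) • (x + y)‖ ^ 2) + lam / 8 * ‖x - y‖ ^ 2 ≤
      (energyDensity Θ (‖x‖ ^ 2) + energyDensity Θ (‖y‖ ^ 2)) / 2 := by
  have hnorm : ‖(1 / 2 : ℝ) • (x + y)‖ = ‖x + y‖ / 2 := by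
    rw [norm_smul, Real.norm_of_nonneg (by norm_num)]; ring
  -- The excess is convex in the norm and, by the triangle inequality, only decreases from the mean
  -- of the norms to the norm of the mean. The quadratic part satisfies the parallelogram law, which
  -- supplies the term in |x − y|².
  have h1 := h.convexOn_excess.2 (mem_Ici.2 (norm_nonneg x)) (mem_Ici.2 (norm_nonneg y))
    (by norm_num : (0 : ℝ) ≤ 1 / 2) (by norm_num : (0 : ℝ) ≤ 1 / 2) (by norm_num)
  have h2 := h.monotoneOn_excess (mem_Ici.2 (norm_nonneg ((1 / 2 : ℝ) • (x + y))))
    (mem_Ici.2 (by positivity : 0 ≤ (1 / 2 : ℝ) • ‖x‖ + (1 / 2 : ℝ) • ‖y‖))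
    (by rw [hnorm, smul_eq_mul, smul_eq_mul]; linarith [norm_add_le x y])
  have h3 := parallelogram_law_with_norm ℝ x y
  simp only [smul_eq_mul] at h1 h2
  have h4 : ‖(1 / 2 : ℝ) • (x + y)‖ ^ 2 = ‖x + y‖ ^ 2 / 4 := by rw [hnorm]; ring
  have h5 : lam / 2 * ‖(1 / 2 : ℝ) • (x + y)‖ ^ 2 = lam / 8 * ‖x + y‖ ^ 2 := by rw [h4]; ring
  have h6 : lam * (‖x + y‖ ^ 2 + ‖x - y‖ ^ 2) = lam * (2 * (‖x‖ ^ 2 + ‖y‖ ^ 2)) := by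
    rw [h3]
  linarith

end Gas

/-! ### Convergence in `L²` -/

section LTwo

variable {α E : Type*} [MeasurableSpace α] {μ : Measure α} [NormedAddCommGroup E]

lemma eLpNorm_two_sq (f : α → E) : eLpNorm f 2 μ ^ 2 = ∫⁻ x, ‖f x‖ₑ ^ 2 ∂μ := by
  have h := eLpNorm_nnreal_pow_eq_lintegral (μ := μ) (f := f) (p := 2) two_ne_zero
  simpa using h

lemma exists_tendsto_eLpNorm_of_cauchy [CompleteSpace E] {f : ℕ → α → E}
    (hf : ∀ k, MemLp (f k) 2 μ)
    (hc : Tendsto (fun q : ℕ × ℕ => eLpNorm (fun x => f q.1 x - f q.2 x) 2 μ) atTop (𝓝 0)) :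
    ∃ g, MemLp g 2 μ ∧ Tendsto (fun k => eLpNorm (fun x => f k x - g x) 2 μ) atTop (𝓝 0) := by
  have hcs : CauchySeq fun k => (hf k).toLp (f k) := by
    rw [Lp.cauchySeq_Lp_iff_cauchySeq_eLpNorm]
    refine hc.congr fun q => eLpNorm_congr_ae ?_
    filter_upwards [(hf q.1).coeFn_toLp, (hf q.2).coeFn_toLp] with x h1 h2
    rw [Pi.sub_apply, h1, h2]
  obtain ⟨g, hg⟩ := cauchySeq_tendsto_of_complete hcs
  refine ⟨g, Lp.memLp g, ?_⟩
  refine ((Lp.tendsto_Lp_iff_tendsto_eLpNorm' _ _).1 hg).congr fun k => eLpNorm_congr_ae ?_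
  filter_upwards [(hf k).coeFn_toLp] with x h1
  rw [Pi.sub_apply, h1]

/-- The filter is arbitrary so that one triangle inequality serves both for pairs of indices (Cauchy
property) and for two approximating sequences. -/
lemma tendsto_eLpNorm_sub_of_tendsto {ι : Type*} {l : Filter ι} {f f' : ι → α → E} {g : α → E}
    (hf : ∀ i, AEStronglyMeasurable (f i) μ) (hf' : ∀ i, AEStronglyMeasurable (f' i) μ)
    (hg : AEStronglyMeasurable g μ)
    (h : Tendsto (fun i => eLpNorm (fun x => f i x - g x) 2 μ) l (𝓝 0))
    (h' : Tendsto (fun i => eLpNorm (fun x => f' i x - g x) 2 μ) l (𝓝 0)) :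
    Tendsto (fun i => eLpNorm (fun x => f i x - f' i x) 2 μ) l (𝓝 0) := by
  have h1 := h.add h'
  rw [add_zero] at h1
  refine tendsto_of_tendsto_of_tendsto_of_le_of_le tendsto_const_nhds h1 (fun _ => zero_le)
    fun i => ?_
  refine le_trans (le_of_eq ?_) (eLpNorm_sub_le ((hf i).sub hg) ((hf' i).sub hg)
    (by norm_num : (1 : ℝ≥0∞) ≤ 2))
  congr 1
  ext x
  simp

lemma tendsto_eLpNorm_cauchy_of_tendsto {f : ℕ → α → E} {g : α → E}
    (hf : ∀ k, AEStronglyMeasurable (f k) μ) (hg : AEStronglyMeasurable g μ)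
    (h : Tendsto (fun k => eLpNorm (fun x => f k x - g x) 2 μ) atTop (𝓝 0)) :
    Tendsto (fun q : ℕ × ℕ => eLpNorm (fun x => f q.1 x - f q.2 x) 2 μ) atTop (𝓝 0) := by
  rw [← prod_atTop_atTop_eq]
  exact tendsto_eLpNorm_sub_of_tendsto (f := fun q : ℕ × ℕ => f q.1) (f' := fun q => f q.2)
    (fun q => hf q.1) (fun q => hf q.2) hg (h.comp tendsto_fst) (h.comp tendsto_snd)

/-- Uniqueness of `L²` limits of two sequences at vanishing distance. -/
lemma ae_eq_of_tendsto_eLpNorm {f f' : ℕ → α → E} {g g' : α → E}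
    (hf : ∀ k, AEStronglyMeasurable (f k) μ) (hf' : ∀ k, AEStronglyMeasurable (f' k) μ)
    (hg : AEStronglyMeasurable g μ) (hg' : AEStronglyMeasurable g' μ)
    (h : Tendsto (fun k => eLpNorm (fun x => f k x - g x) 2 μ) atTop (𝓝 0))
    (h' : Tendsto (fun k => eLpNorm (fun x => f' k x - g' x) 2 μ) atTop (𝓝 0))
    (hff : Tendsto (fun k => eLpNorm (fun x => f k x - f' k x) 2 μ) atTop (𝓝 0)) :
    g =ᵐ[μ] g' := by
  have h1 := (hff.add h').add h
  rw [add_zero, add_zero] at h1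
  have h2 : eLpNorm (g - g') 2 μ ≤ 0 := by
    refine ge_of_tendsto' h1 fun k => ?_
    have e : g - g' = (fun x => f k x - f' k x) + (fun x => f' k x - g' x) -
        (fun x => f k x - g x) := by ext x; simp
    rw [e]
    refine (eLpNorm_sub_le (((hf k).sub (hf' k)).add ((hf' k).sub hg')) ((hf k).sub hg)
      (by norm_num)).trans (add_le_add ?_ le_rfl)
    exact eLpNorm_add_le ((hf k).sub (hf' k)) ((hf' k).sub hg') (by norm_num)
  have h3 := (eLpNorm_eq_zero_iff (hg.sub hg') two_ne_zero).1 (le_antisymm h2 zero_le)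
  filter_upwards [h3] with x hx
  exact sub_eq_zero.1 hx

/-- Cauchy–Schwarz. It passes to the limit in the definition of weak gradients and, with φ = 1, in
the outlet integral. -/
lemma tendsto_integral_mul_of_tendsto_eLpNorm {f : ℕ → α → ℝ} {g φ : α → ℝ}
    (hf : ∀ k, MemLp (f k) 2 μ) (hg : MemLp g 2 μ) (hφ : MemLp φ 2 μ)
    (h : Tendsto (fun k => eLpNorm (fun x => f k x - g x) 2 μ) atTop (𝓝 0)) :
    Tendsto (fun k => ∫ x, f k x * φ x ∂μ) atTop (𝓝 (∫ x, g x * φ x ∂μ)) := by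
  refine tendsto_integral_of_L1' _ (hg.integrable_mul hφ).aestronglyMeasurable
    (Eventually.of_forall fun k => (hf k).integrable_mul hφ) ?_
  have h1 : Tendsto (fun k => eLpNorm (fun x => f k x - g x) 2 μ * eLpNorm φ 2 μ) atTop
      (𝓝 (0 * eLpNorm φ 2 μ)) :=
    ENNReal.Tendsto.mul_const h (Or.inr hφ.eLpNorm_ne_top)
  rw [zero_mul] at h1
  refine tendsto_of_tendsto_of_tendsto_of_le_of_le tendsto_const_nhds h1 (fun _ => zero_le)
    fun k => ?_
  refine le_trans (le_of_eq ?_) (eLpNorm_smul_le_mul_eLpNorm (r := 1)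
    hφ.aestronglyMeasurable ((hf k).sub hg).aestronglyMeasurable)
  congr 1
  ext x
  simp [sub_mul]

/-- Continuity on `L²` of the integral of a function of quadratic growth. -/
lemma tendsto_integral_comp_of_tendsto_eLpNorm {Φ : E → ℝ} (hΦ : Continuous Φ) (hΦ0 : Φ 0 = 0)
    {C : ℝ} (hC : ∀ a b, |Φ a - Φ b| ≤ C * (‖a - b‖ * (‖a‖ + ‖b‖)))
    {f : ℕ → α → E} {g : α → E} (hf : ∀ k, MemLp (f k) 2 μ) (hg : MemLp g 2 μ)
    (h : Tendsto (fun k => eLpNorm (fun x => f k x - g x) 2 μ) atTop (𝓝 0)) :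
    Tendsto (fun k => ∫ x, Φ (f k x) ∂μ) atTop (𝓝 (∫ x, Φ (g x) ∂μ)) := by
  have hint : ∀ g : α → E, MemLp g 2 μ → Integrable (fun x => Φ (g x)) μ := by
    intro g hg
    refine ((hg.integrable_norm_pow two_ne_zero).const_mul C).mono'
      (hΦ.comp_aestronglyMeasurable hg.aestronglyMeasurable) (Eventually.of_forall fun x => ?_)
    have := hC (g x) 0
    simpa [hΦ0, sq] using this
  refine tendsto_integral_of_L1' _ (hint g hg).aestronglyMeasurable
    (Eventually.of_forall fun k => hint _ (hf k)) ?_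
  have h1 : Tendsto (fun k => ENNReal.ofReal C * (eLpNorm (fun x => f k x - g x) 2 μ *
      (eLpNorm (fun x => f k x - g x) 2 μ + (eLpNorm g 2 μ + eLpNorm g 2 μ)))) atTop
      (𝓝 (ENNReal.ofReal C * (0 * (0 + (eLpNorm g 2 μ + eLpNorm g 2 μ))))) := by
    have hne : 0 + (eLpNorm g 2 μ + eLpNorm g 2 μ) ≠ ⊤ := by
      simp [hg.eLpNorm_ne_top]
    refine ENNReal.Tendsto.const_mul (ENNReal.Tendsto.mul h (Or.inr hne)
      (h.add tendsto_const_nhds) (Or.inr ENNReal.zero_ne_top)) (Or.inr ENNReal.ofReal_ne_top)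
  rw [zero_mul, mul_zero] at h1
  refine tendsto_of_tendsto_of_tendsto_of_le_of_le tendsto_const_nhds h1 (fun _ => zero_le)
    fun k => ?_
  have hsub : MemLp (fun x => f k x - g x) 2 μ := (hf k).sub hg
  have hm1 := hsub.aestronglyMeasurable
  have hm2 := hg.aestronglyMeasurable
  set a : α → ℝ := fun x => ‖f k x - g x‖
  -- Bounding ‖f k‖ by ‖f k − g‖ + ‖g‖ leaves only the vanishing difference and the fixed g.
  set b : α → ℝ := fun x => ‖f k x - g x‖ + (‖g x‖ + ‖g x‖)
  calc eLpNorm (fun x => Φ (f k x) - Φ (g x)) 1 μ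
      ≤ ENNReal.ofReal C * eLpNorm (a • b) 1 μ := by
        refine eLpNorm_le_mul_eLpNorm_of_ae_le_mul (Eventually.of_forall fun x => ?_) 1
        have h2 : ‖f k x‖ ≤ ‖f k x - g x‖ + ‖g x‖ := by
          simpa using norm_add_le (f k x - g x) (g x)
        rcases le_or_gt 0 C with hC0 | hC0
        · calc _ ≤ C * (‖f k x - g x‖ * (‖f k x‖ + ‖g x‖)) := hC _ _
            _ ≤ C * (‖f k x - g x‖ * (‖f k x - g x‖ + (‖g x‖ + ‖g x‖))) := by
              gcongr ?_ * (?_ * ?_)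
              linarith
            _ = _ := by
              rw [Pi.smul_apply', smul_eq_mul, Real.norm_of_nonneg (by positivity)]
        -- For C < 0 the constant `ENNReal.ofReal C` is 0, but then the hypothesis forces both sides
        -- to vanish.
        · have h3 := hC (f k x) (g x)
          have h4 : 0 ≤ ‖f k x - g x‖ * (‖f k x‖ + ‖g x‖) := by positivity
          have h5 := abs_nonneg (Φ (f k x) - Φ (g x))
          have h6 : ‖f k x - g x‖ * (‖f k x‖ + ‖g x‖) = 0 := by nlinarith
          have h7 : a x * b x = 0 := by
            rcases mul_eq_zero.1 h6 with h | h
            · simp [a, h]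
            · have hf0 : ‖f k x‖ = 0 := by linarith [norm_nonneg (f k x), norm_nonneg (g x)]
              have hg0 : ‖g x‖ = 0 := by linarith [norm_nonneg (f k x), norm_nonneg (g x)]
              simp [a, norm_eq_zero.1 hf0, norm_eq_zero.1 hg0]
          rw [Pi.smul_apply', smul_eq_mul, h7, norm_zero, mul_zero, Real.norm_eq_abs]
          rwa [h6, mul_zero] at h3
    _ ≤ ENNReal.ofReal C * (eLpNorm a 2 μ * eLpNorm b 2 μ) := by
        gcongr
        exact eLpNorm_smul_le_mul_eLpNorm (hm1.norm.add (hm2.norm.add hm2.norm)) hm1.norm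
    _ ≤ _ := by
        gcongr
        · exact (eLpNorm_norm _).le
        · refine (eLpNorm_add_le hm1.norm (hm2.norm.add hm2.norm) (by norm_num)).trans ?_
          gcongr
          · exact (eLpNorm_norm _).le
          · refine (eLpNorm_add_le hm2.norm hm2.norm (by norm_num)).trans ?_
            rw [eLpNorm_norm]

lemma memLp_of_continuous_of_isBounded {F X : Type*} [NormedAddCommGroup F] [PseudoMetricSpace X]
    [ProperSpace X] [MeasurableSpace X] [OpensMeasurableSpace X]
    [SecondCountableTopology F] {ν : Measure X} [IsFiniteMeasureOnCompacts ν] {U : Set X}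
    (hU : Bornology.IsBounded U) (hm : MeasurableSet U) {f : X → F} (hf : Continuous f) :
    MemLp f 2 (ν.restrict U) := by
  have hfin : IsFiniteMeasure (ν.restrict U) :=
    ⟨by rw [Measure.restrict_apply_univ]; exact hU.measure_lt_top⟩
  obtain ⟨C, hC⟩ := hU.isCompact_closure.exists_bound_of_continuousOn hf.continuousOn
  borelize F
  exact MemLp.of_bound hf.measurable.aestronglyMeasurable C
    ((ae_restrict_iff' hm).2 (Eventually.of_forall fun x hx => hC x (subset_closure hx)))

end LTwo

/-! ### Weak gradients -/

section WeakGradient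

variable {d : ℕ} {U : Set (EuclideanSpace ℝ (Fin (d + 1)))}
  {u : EuclideanSpace ℝ (Fin (d + 1)) → ℝ}
  {g g' : EuclideanSpace ℝ (Fin (d + 1)) → EuclideanSpace ℝ (Fin (d + 1))}

lemma memLp_of_hasCompactSupport {ζ : EuclideanSpace ℝ (Fin (d + 1)) → ℝ} (hζ : Continuous ζ)
    (hc : HasCompactSupport ζ) : MemLp ζ 2 (volume.restrict U) :=
  (hζ.memLp_of_hasCompactSupport hc).restrict U

lemma memLp_fderiv_of_hasCompactSupport {ζ : EuclideanSpace ℝ (Fin (d + 1)) → ℝ}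
    (hζ : ContDiff ℝ ∞ ζ) (hc : HasCompactSupport ζ) (v : EuclideanSpace ℝ (Fin (d + 1))) :
    MemLp (fun x => fderiv ℝ ζ x v) 2 (volume.restrict U) :=
  memLp_of_hasCompactSupport ((hζ.continuous_fderiv (by simp)).clm_apply continuous_const)
    (hc.fderiv_apply ℝ v)

/-- The weak gradient is unique. -/
lemma IsWeakGradient.ae_eq (hU : IsOpen U) (h : IsWeakGradient U u g)
    (h' : IsWeakGradient U u g') : g =ᵐ[volume.restrict U] g' := by
  have hsub : MemLp (fun x => g x - g' x) 2 (volume.restrict U) := h.1.sub h'.1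
  have key : ∀ᵐ x ∂volume, x ∈ U → g x - g' x = 0 := by
    refine hU.ae_eq_zero_of_integral_contDiff_smul_eq_zero ?_ fun ζ hζ hc hs => ?_
    · refine (locallyIntegrableOn_of_locallyIntegrable_restrict ?_)
      exact hsub.locallyIntegrable (by norm_num)
    · rw [← setIntegral_eq_integral_of_forall_compl_eq_zero (s := U)]
      swap
      · intro x hx
        rw [image_eq_zero_of_notMem_tsupport fun hx' => hx (hs hx'), zero_smul]
      have hζ2 := memLp_of_hasCompactSupport (U := U) hζ.continuous hc
      have hint : Integrable (fun x => ζ x • (g x - g' x)) (volume.restrict U) :=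
        memLp_one_iff_integrable.1 (hsub.smul hζ2)
      -- A vector integral vanishes once its inner product with each v does; the definition of the
      -- weak gradient tests exactly these.
      refine ext_inner_left ℝ fun v => ?_
      rw [← integral_inner hint, inner_zero_right]
      have h1 := h.2 ζ hζ hc hs v
      rw [h'.2 ζ hζ hc hs v, neg_inj] at h1
      have hi : ∀ f : EuclideanSpace ℝ (Fin (d + 1)) → EuclideanSpace ℝ (Fin (d + 1)),
          MemLp f 2 (volume.restrict U) →
          Integrable (fun x => inner ℝ (f x) v * ζ x) (volume.restrict U) := fun f hf =>
        (hf.inner_const v).integrable_mul hζ2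
      calc ∫ x in U, inner ℝ v (ζ x • (g x - g' x))
          = ∫ x in U, (inner ℝ (g x) v * ζ x - inner ℝ (g' x) v * ζ x) := by
            congr 1
            ext x
            rw [real_inner_smul_right, real_inner_comm, inner_sub_left]
            ring
        _ = 0 := by rw [integral_sub (hi g h.1) (hi g' h'.1), h1, sub_self]
  rw [EventuallyEq, ae_restrict_iff' hU.measurableSet]
  filter_upwards [key] with x hx hxU
  exact sub_eq_zero.1 (hx hxU)

lemma MemH1.isWeakGradient (h : MemH1 U u) : IsWeakGradient U u (weakGradient U u) := by
  rw [weakGradient, dif_pos h.2]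
  exact h.2.choose_spec

lemma IsWeakGradient.weakGradient_ae_eq (hU : IsOpen U) (hu : MemLp u 2 (volume.restrict U))
    (h : IsWeakGradient U u g) : weakGradient U u =ᵐ[volume.restrict U] g :=
  IsWeakGradient.ae_eq hU (MemH1.isWeakGradient ⟨hu, g, h⟩) h

/-- A `C¹` function has its gradient as weak gradient. -/
lemma isWeakGradient_gradient (hU : IsOpen U) (hb : Bornology.IsBounded U)
    {v : EuclideanSpace ℝ (Fin (d + 1)) → ℝ} (hv : ContDiff ℝ 1 v) :
    IsWeakGradient U v (gradient v) := by
  refine ⟨memLp_of_continuous_of_isBounded hb hU.measurableSet hv.continuous_gradient,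
    fun ζ hζ hc hs w => ?_⟩
  have hz : ∀ x, x ∉ U → ζ x = 0 := fun x hx =>
    image_eq_zero_of_notMem_tsupport fun hx' => hx (hs hx')
  have hz' : ∀ x, x ∉ U → fderiv ℝ ζ x w = 0 := fun x hx => by
    rw [image_eq_zero_of_notMem_tsupport (f := fderiv ℝ ζ)
      fun hx' => hx (hs (tsupport_fderiv_subset ℝ hx'))]
    simp
  -- The test function and its derivative vanish off U and v is C¹ everywhere, so integration by
  -- parts takes place on the whole space.
  rw [setIntegral_eq_integral_of_forall_compl_eq_zero fun x hx => by rw [hz' x hx, mul_zero],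
    setIntegral_eq_integral_of_forall_compl_eq_zero fun x hx => by rw [hz x hx, mul_zero]]
  simp only [inner_gradient]
  have hcζ : HasCompactSupport (fun x => fderiv ℝ ζ x w) := hc.fderiv_apply ℝ w
  have hdv : Continuous fun x => fderiv ℝ v x w :=
    (hv.continuous_fderiv one_ne_zero).clm_apply continuous_const
  have hdζ : Continuous fun x => fderiv ℝ ζ x w :=
    (hζ.continuous_fderiv (by simp)).clm_apply continuous_const
  refine integral_mul_fderiv_eq_neg_fderiv_mul_of_integrable ?_ ?_ ?_
    (fun x _ => hv.differentiable one_ne_zero x) (fun x _ => hζ.differentiable (by simp) x)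
  · exact (hdv.mul hζ.continuous).integrable_of_hasCompactSupport hc.mul_left
  · exact (hv.continuous.mul hdζ).integrable_of_hasCompactSupport hcζ.mul_left
  · exact (hv.continuous.mul hζ.continuous).integrable_of_hasCompactSupport hc.mul_left

/-- Weak gradients are stable under `L²` limits. -/
lemma isWeakGradient_of_tendsto
    {v : ℕ → EuclideanSpace ℝ (Fin (d + 1)) → ℝ}
    {G : ℕ → EuclideanSpace ℝ (Fin (d + 1)) → EuclideanSpace ℝ (Fin (d + 1))}
    (hv : ∀ k, MemLp (v k) 2 (volume.restrict U)) (hG : ∀ k, IsWeakGradient U (v k) (G k))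
    (hu : MemLp u 2 (volume.restrict U)) (hg : MemLp g 2 (volume.restrict U))
    (hvu : Tendsto (fun k => eLpNorm (fun x => v k x - u x) 2 (volume.restrict U)) atTop (𝓝 0))
    (hGg : Tendsto (fun k => eLpNorm (fun x => G k x - g x) 2 (volume.restrict U)) atTop (𝓝 0)) :
    IsWeakGradient U u g := by
  refine ⟨hg, fun ζ hζ hc hs w => ?_⟩
  have h1 := tendsto_integral_mul_of_tendsto_eLpNorm hv hu
    (memLp_fderiv_of_hasCompactSupport hζ hc w) hvu
  have hGw : Tendsto (fun k => eLpNorm (fun x => inner ℝ (G k x) w - inner ℝ (g x) w) 2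
      (volume.restrict U)) atTop (𝓝 0) := by
    have h2 := ENNReal.Tendsto.const_mul (a := ENNReal.ofReal ‖w‖) hGg
      (Or.inr ENNReal.ofReal_ne_top)
    rw [mul_zero] at h2
    refine tendsto_of_tendsto_of_tendsto_of_le_of_le tendsto_const_nhds h2 (fun _ => zero_le)
      fun k => eLpNorm_le_mul_eLpNorm_of_ae_le_mul (Eventually.of_forall fun x => ?_) 2
    rw [← inner_sub_left, mul_comm]
    exact norm_inner_le_norm _ _
  have h2 := tendsto_integral_mul_of_tendsto_eLpNorm (fun k => (hG k).1.inner_const w)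
    (hg.inner_const w) (memLp_of_hasCompactSupport (U := U) hζ.continuous hc) hGw
  refine tendsto_nhds_unique h1 (h2.neg.congr fun k => ?_)
  rw [(hG k).2 ζ hζ hc hs w]

end WeakGradient

/-! ### Square integrals -/

section Squares

variable {α E : Type*} [MeasurableSpace α] {μ : Measure α} [NormedAddCommGroup E]

lemma eLpNorm_two_eq_sqrt {f : α → E} (hf : MemLp f 2 μ) :
    eLpNorm f 2 μ = ENNReal.ofReal √(∫ x, ‖f x‖ ^ 2 ∂μ) := by
  have h1 : ENNReal.ofReal (∫ x, ‖f x‖ ^ 2 ∂μ) = eLpNorm f 2 μ ^ 2 := by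
    rw [eLpNorm_two_sq, ofReal_integral_eq_lintegral_ofReal (hf.integrable_norm_pow two_ne_zero)
      (Eventually.of_forall fun x => by positivity)]
    congr 1
    ext x
    rw [ENNReal.ofReal_pow (norm_nonneg _), ofReal_norm]
  have h2 : ENNReal.ofReal √(∫ x, ‖f x‖ ^ 2 ∂μ) ^ 2 = eLpNorm f 2 μ ^ 2 := by
    rw [← h1, ← ENNReal.ofReal_pow (Real.sqrt_nonneg _),
      Real.sq_sqrt (integral_nonneg fun x => by positivity)]
  exact le_antisymm ((ENNReal.pow_le_pow_left_iff two_ne_zero).1 h2.ge)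
    ((ENNReal.pow_le_pow_left_iff two_ne_zero).1 h2.le)

lemma integral_norm_sq_eq {f : α → E} (hf : MemLp f 2 μ) :
    ∫ x, ‖f x‖ ^ 2 ∂μ = (eLpNorm f 2 μ).toReal ^ 2 := by
  rw [eLpNorm_two_eq_sqrt hf, ENNReal.toReal_ofReal (Real.sqrt_nonneg _),
    Real.sq_sqrt (integral_nonneg fun x => by positivity)]

lemma tendsto_eLpNorm_two_zero {ι : Type*} {l : Filter ι} {f : ι → α → E}
    (hf : ∀ i, MemLp (f i) 2 μ) (h : Tendsto (fun i => ∫ x, ‖f i x‖ ^ 2 ∂μ) l (𝓝 0)) :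
    Tendsto (fun i => eLpNorm (f i) 2 μ) l (𝓝 0) := by
  simp_rw [fun i => eLpNorm_two_eq_sqrt (hf i)]
  have := ENNReal.tendsto_ofReal ((Real.continuous_sqrt.tendsto 0).comp h)
  simpa using this

/-- Cauchy–Schwarz inequality on a finite measure space. -/
lemma integral_norm_le_sqrt [IsFiniteMeasure μ] {f : α → E} (hf : MemLp f 2 μ) :
    ∫ x, ‖f x‖ ∂μ ≤ √(μ.real univ * ∫ x, ‖f x‖ ^ 2 ∂μ) := by
  refine Real.le_sqrt_of_sq_le ?_
  rw [integral_norm_sq_eq hf, integral_norm_eq_lintegral_enorm hf.aestronglyMeasurable,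
    ← ENNReal.toReal_pow, ← ENNReal.toReal_pow, measureReal_def, ← ENNReal.toReal_mul,
    eLpNorm_two_sq]
  refine ENNReal.toReal_mono ?_ (sq_lintegral_le μ hf.aestronglyMeasurable.enorm)
  rw [← eLpNorm_two_sq]
  exact ENNReal.mul_ne_top (measure_ne_top _ _) (ENNReal.pow_ne_top hf.eLpNorm_ne_top)

end Squares

/-! ### Gradients of differences, midpoints and regularized absolute values -/

lemma gradient_sub_apply {E : Type*} [NormedAddCommGroup E] [InnerProductSpace ℝ E]
    [CompleteSpace E] {v w : E → ℝ} (hv : ContDiff ℝ 1 v) (hw : ContDiff ℝ 1 w) (x : E) :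
    gradient (fun y => v y - w y) x = gradient v x - gradient w x := by
  rw [gradient, fderiv_fun_sub (hv.differentiable one_ne_zero x)
    (hw.differentiable one_ne_zero x), map_sub]
  rfl

lemma gradient_midpoint_apply {E : Type*} [NormedAddCommGroup E] [InnerProductSpace ℝ E]
    [CompleteSpace E] {v w : E → ℝ} (hv : ContDiff ℝ 1 v) (hw : ContDiff ℝ 1 w) (x : E) :
    gradient (fun y => (1 / 2 : ℝ) * (v y + w y)) x =
      (1 / 2 : ℝ) • (gradient v x + gradient w x) := by
  have h1 := hv.differentiable one_ne_zero x
  have h2 := hw.differentiable one_ne_zero x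
  rw [gradient, fderiv_const_mul (h1.fun_add h2), fderiv_fun_add h1 h2, map_smul, map_add]
  rfl

/-- Regularized absolute value. -/
lemma exists_smooth_abs {E : Type*} [NormedAddCommGroup E] [InnerProductSpace ℝ E]
    [CompleteSpace E] {v : E → ℝ} (hv : ContDiff ℝ 1 v) {ε : ℝ} (hε : 0 < ε) :
    ∃ w : E → ℝ, ContDiff ℝ 1 w ∧ (∀ x, 0 ≤ w x) ∧ (∀ x, |w x| ≤ |v x|) ∧
      (∀ x, v x - ε ≤ w x) ∧ ∀ x, ‖gradient w x‖ ≤ ‖gradient v x‖ := by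
  have hpos : ∀ t : ℝ, 0 < t ^ 2 + ε ^ 2 := fun t => by positivity
  have hge : ∀ t : ℝ, |t| ≤ √(t ^ 2 + ε ^ 2) := fun t => by
    rw [← Real.sqrt_sq_eq_abs]
    exact Real.sqrt_le_sqrt (by linarith [sq_nonneg ε])
  have hgeε : ∀ t : ℝ, ε ≤ √(t ^ 2 + ε ^ 2) := fun t =>
    Real.le_sqrt_of_sq_le (by linarith [sq_nonneg t])
  -- Subtracting ε gives |w| ≤ |v|, so a bound at the inlet is inherited; the cost is at most ε
  -- where v is positive.
  refine ⟨fun x => √(v x ^ 2 + ε ^ 2) - ε, ?_, fun x => sub_nonneg.2 (hgeε _), fun x => ?_,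
    fun x => ?_, fun x => ?_⟩
  · exact (((hv.pow 2).add contDiff_const).sqrt fun x => (hpos _).ne').sub contDiff_const
  · rw [abs_of_nonneg (sub_nonneg.2 (hgeε _)), sub_le_iff_le_add,
      Real.sqrt_le_left (by positivity)]
    nlinarith [abs_nonneg (v x), sq_abs (v x)]
  · linarith [le_abs_self (v x), hge (v x)]
  · have h1 : HasDerivAt (fun t : ℝ => √(t ^ 2 + ε ^ 2) - ε) (v x / √(v x ^ 2 + ε ^ 2)) (v x) := by
      refine ((((hasDerivAt_pow 2 (v x)).add_const _).sqrt (hpos _).ne').sub_const ε).congr_deriv ?_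
      have := (Real.sqrt_pos.2 (hpos (v x))).ne'
      field_simp
      simp
    have h2 := h1.comp_hasFDerivAt x (hv.differentiable one_ne_zero x).hasFDerivAt
    rw [norm_gradient, norm_gradient]
    have h3 : fderiv ℝ (fun x => √(v x ^ 2 + ε ^ 2) - ε) x = _ := h2.fderiv
    rw [h3, norm_smul, Real.norm_eq_abs, abs_div, abs_of_nonneg (Real.sqrt_nonneg _)]
    refine mul_le_of_le_one_left (norm_nonneg _) ?_
    rw [div_le_one (Real.sqrt_pos.2 (hpos _))]
    exact hge _

/-! ### The functional on continuously differentiable functions -/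

section SmoothFunctional

variable {d : ℕ} {K : ℝ} {Ω : Set (EuclideanSpace ℝ (Fin (d + 1)))}
  {T S : EuclideanSpace ℝ (Fin (d + 1)) → EuclideanSpace ℝ (Fin (d + 1))}

/-- The functional `J` evaluated at a `C¹` function. -/
noncomputable def smoothJ (Ω : Set (EuclideanSpace ℝ (Fin (d + 1)))) (Θ : ℝ → ℝ) (m₀ L : ℝ)
    (v : EuclideanSpace ℝ (Fin (d + 1)) → ℝ) : ℝ :=
  (∫ x in truncNozzle Ω L, energyDensity Θ (‖gradient v x‖ ^ 2)) -
    m₀ / volume.real (crossSection Ω L) * ∫ x' in crossSection Ω L, v (slicePoint x' L)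

/-- A + 1 stands in for √A, since (A+1)² ≥ A. -/
lemma eLpNorm_le_of_sq_le {A : ℝ≥0} {a b c : ℝ≥0∞} (h : a ^ 2 ≤ A * (b ^ 2 + c ^ 2)) :
    a ≤ (A + 1 : ℝ≥0) * (b + c) := by
  refine (ENNReal.pow_le_pow_left_iff two_ne_zero).1 (h.trans ?_)
  rw [mul_pow]
  refine mul_le_mul' ?_ ?_
  · exact_mod_cast (by nlinarith [sq_nonneg A, A.2] : A ≤ (A + 1) ^ 2)
  · rw [add_sq]
    exact add_le_add le_self_add le_rfl

lemma IsSliceMap.exists_eLpNorm_trace_le (h : IsSliceMap K (unitCylinder d) Ω S T)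
    (h' : IsSliceMap K Ω (unitCylinder d) T S) {L : ℝ} (hL : 0 < L) :
    ∃ A : ℝ≥0, ∀ v : EuclideanSpace ℝ (Fin (d + 1)) → ℝ, ContDiff ℝ 1 v →
      eLpNorm (fun x' => v (slicePoint x' L)) 2 (volume.restrict (crossSection Ω L)) ≤
        A * (eLpNorm v 2 (volume.restrict (truncNozzle Ω L)) +
          eLpNorm (gradient v) 2 (volume.restrict (truncNozzle Ω L))) := by
  obtain ⟨A, hA⟩ := h.exists_trace_le h' hL
  refine ⟨A + 1, fun v hv => eLpNorm_le_of_sq_le ?_⟩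
  simpa only [eLpNorm_two_sq] using hA v hv

lemma IsSliceMap.exists_eLpNorm_poincare_le (h : IsSliceMap K (unitCylinder d) Ω S T)
    (h' : IsSliceMap K Ω (unitCylinder d) T S) {L : ℝ} (hL : 0 < L) :
    ∃ A : ℝ≥0, ∀ v : EuclideanSpace ℝ (Fin (d + 1)) → ℝ, ContDiff ℝ 1 v →
      eLpNorm v 2 (volume.restrict (truncNozzle Ω L)) ≤
        A * (eLpNorm (fun x' => v (slicePoint x' (-L))) 2
            (volume.restrict (crossSection Ω (-L))) +
          eLpNorm (gradient v) 2 (volume.restrict (truncNozzle Ω L))) := by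
  obtain ⟨A, hA⟩ := h.exists_poincare_le h' hL
  refine ⟨A + 1, fun v hv => eLpNorm_le_of_sq_le ?_⟩
  simpa only [eLpNorm_two_sq] using hA v hv

lemma IsSliceMap.isFiniteMeasure_truncNozzle (h : IsSliceMap K (unitCylinder d) Ω S T)
    (h' : IsSliceMap K Ω (unitCylinder d) T S) (L : ℝ) :
    IsFiniteMeasure (volume.restrict (truncNozzle Ω L)) :=
  ⟨by rw [Measure.restrict_apply_univ]; exact (h.isBounded_truncNozzle h' L).measure_lt_top⟩

lemma IsSliceMap.isFiniteMeasure_crossSection (h : IsSliceMap K (unitCylinder d) Ω S T)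
    (h' : IsSliceMap K Ω (unitCylinder d) T S) (t : ℝ) :
    IsFiniteMeasure (volume.restrict (crossSection Ω t)) :=
  ⟨by rw [Measure.restrict_apply_univ]; exact (h.isBounded_crossSection h' t).measure_lt_top⟩

lemma IsSliceMap.memLp_truncNozzle (h : IsSliceMap K (unitCylinder d) Ω S T)
    (h' : IsSliceMap K Ω (unitCylinder d) T S) (L : ℝ) {F : Type*} [NormedAddCommGroup F]
    [SecondCountableTopology F] {f : EuclideanSpace ℝ (Fin (d + 1)) → F} (hf : Continuous f) :
    MemLp f 2 (volume.restrict (truncNozzle Ω L)) :=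
  memLp_of_continuous_of_isBounded (h.isBounded_truncNozzle h' L)
    (isOpen_truncNozzle h'.isOpen L).measurableSet hf

lemma IsSliceMap.memLp_crossSection (h : IsSliceMap K (unitCylinder d) Ω S T)
    (h' : IsSliceMap K Ω (unitCylinder d) T S) (t : ℝ)
    {v : EuclideanSpace ℝ (Fin (d + 1)) → ℝ} (hv : Continuous v) :
    MemLp (fun x' => v (slicePoint x' t)) 2 (volume.restrict (crossSection Ω t)) :=
  memLp_of_continuous_of_isBounded (h.isBounded_crossSection h' t)
    (isOpen_crossSection h'.isOpen t).measurableSet (hv.comp (continuous_slicePoint_left t))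

variable {Θ : ℝ → ℝ} {lam Lam m₀ L : ℝ}

lemma IsSliceMap.integrable_energy (h : IsSliceMap K (unitCylinder d) Ω S T)
    (h' : IsSliceMap K Ω (unitCylinder d) T S) (hE : IsElliptic lam Lam Θ) (L : ℝ)
    {v : EuclideanSpace ℝ (Fin (d + 1)) → ℝ} (hv : ContDiff ℝ 1 v) :
    Integrable (fun x => energyDensity Θ (‖gradient v x‖ ^ 2))
      (volume.restrict (truncNozzle Ω L)) := by
  have := h.isFiniteMeasure_truncNozzle h' L
  exact (h.memLp_truncNozzle h' L
    (hE.continuous_energyDensity_norm_sq.comp hv.continuous_gradient)).integrable one_le_two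

lemma IsSliceMap.integrable_outlet (h : IsSliceMap K (unitCylinder d) Ω S T)
    (h' : IsSliceMap K Ω (unitCylinder d) T S) (t : ℝ)
    {v : EuclideanSpace ℝ (Fin (d + 1)) → ℝ} (hv : Continuous v) :
    Integrable (fun x' => v (slicePoint x' t)) (volume.restrict (crossSection Ω t)) := by
  have := h.isFiniteMeasure_crossSection h' t
  exact (h.memLp_crossSection h' t hv).integrable one_le_two

/-- Strong convexity of the functional. -/
lemma IsSliceMap.smoothJ_midpoint_le (h : IsSliceMap K (unitCylinder d) Ω S T)
    (h' : IsSliceMap K Ω (unitCylinder d) T S) (hE : IsElliptic lam Lam Θ)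
    {v w : EuclideanSpace ℝ (Fin (d + 1)) → ℝ} (hv : ContDiff ℝ 1 v) (hw : ContDiff ℝ 1 w) :
    smoothJ Ω Θ m₀ L (fun x => (1 / 2 : ℝ) * (v x + w x)) +
      lam / 8 * ∫ x in truncNozzle Ω L, ‖gradient v x - gradient w x‖ ^ 2 ≤
      (smoothJ Ω Θ m₀ L v + smoothJ Ω Θ m₀ L w) / 2 := by
  have hmid : ContDiff ℝ 1 fun x => (1 / 2 : ℝ) * (v x + w x) := contDiff_const.mul (hv.add hw)
  have hIv := h.integrable_energy h' hE L hv
  have hIw := h.integrable_energy h' hE L hw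
  have hIm := h.integrable_energy h' hE L hmid
  have hId : Integrable (fun x => ‖gradient v x - gradient w x‖ ^ 2)
      (volume.restrict (truncNozzle Ω L)) := (h.memLp_truncNozzle h' L
    (hv.continuous_gradient.sub hw.continuous_gradient)).integrable_norm_pow two_ne_zero
  have h1 : (∫ x in truncNozzle Ω L, energyDensity Θ
        (‖gradient (fun x => (1 / 2 : ℝ) * (v x + w x)) x‖ ^ 2)) +
      lam / 8 * ∫ x in truncNozzle Ω L, ‖gradient v x - gradient w x‖ ^ 2 ≤
      ((∫ x in truncNozzle Ω L, energyDensity Θ (‖gradient v x‖ ^ 2)) +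
        ∫ x in truncNozzle Ω L, energyDensity Θ (‖gradient w x‖ ^ 2)) / 2 := by
    rw [← integral_const_mul, ← integral_add hIm (hId.const_mul _), ← integral_add hIv hIw,
      ← integral_div]
    refine integral_mono (hIm.add (hId.const_mul _)) ((hIv.add hIw).div_const 2) fun x => ?_
    have := hE.energyDensity_midpoint_le (gradient v x) (gradient w x)
    rw [← gradient_midpoint_apply hv hw] at this
    exact this
  -- The outlet term is linear, so it neither helps nor hurts convexity.
  have h2 : ∫ x' in crossSection Ω L, (1 / 2 : ℝ) * (v (slicePoint x' L) + w (slicePoint x' L)) =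
      1 / 2 * ((∫ x' in crossSection Ω L, v (slicePoint x' L)) +
        ∫ x' in crossSection Ω L, w (slicePoint x' L)) := by
    rw [integral_const_mul, integral_add (h.integrable_outlet h' L hv.continuous)
      (h.integrable_outlet h' L hw.continuous)]
  simp only [smoothJ]
  rw [h2]
  linarith

/-- Nonnegative competitors. -/
lemma IsSliceMap.exists_nonneg_smoothJ_le (h : IsSliceMap K (unitCylinder d) Ω S T)
    (h' : IsSliceMap K Ω (unitCylinder d) T S) (hE : IsElliptic lam Lam Θ) (hm : 0 < m₀)
    {v : EuclideanSpace ℝ (Fin (d + 1)) → ℝ} (hv : ContDiff ℝ 1 v) {ε : ℝ} (hε : 0 < ε) :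
    ∃ w, ContDiff ℝ 1 w ∧ (∀ x, 0 ≤ w x) ∧ (∀ x, |w x| ≤ |v x|) ∧
      smoothJ Ω Θ m₀ L w ≤ smoothJ Ω Θ m₀ L v + m₀ * ε := by
  obtain ⟨w, hw, hw0, hwv, hvw, hgrad⟩ := exists_smooth_abs hv hε
  refine ⟨w, hw, hw0, hwv, ?_⟩
  have hfin := h.isFiniteMeasure_crossSection h' L
  have h1 : ∫ x in truncNozzle Ω L, energyDensity Θ (‖gradient w x‖ ^ 2) ≤
      ∫ x in truncNozzle Ω L, energyDensity Θ (‖gradient v x‖ ^ 2) :=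
    integral_mono (h.integrable_energy h' hE L hw) (h.integrable_energy h' hE L hv)
      fun x => hE.energyDensity_mono (norm_nonneg _) (hgrad x)
  have h2 : (∫ x' in crossSection Ω L, v (slicePoint x' L)) -
      ε * volume.real (crossSection Ω L) ≤ ∫ x' in crossSection Ω L, w (slicePoint x' L) := by
    have h3 : ∫ _ in crossSection Ω L, ε = ε * volume.real (crossSection Ω L) := by
      rw [setIntegral_const, smul_eq_mul, mul_comm]
    rw [← h3, ← integral_sub (h.integrable_outlet h' L hv.continuous) (integrable_const _)]
    exact integral_mono ((h.integrable_outlet h' L hv.continuous).sub (integrable_const _))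
      (h.integrable_outlet h' L hw.continuous) fun x' => hvw _
  have h4 := mul_le_mul_of_nonneg_left h2
    (div_nonneg hm.le (measureReal_nonneg (μ := volume) (s := crossSection Ω L)))
  have h5 : m₀ / volume.real (crossSection Ω L) * (ε * volume.real (crossSection Ω L)) ≤
      m₀ * ε := by
    -- If the area were 0, division by zero would give 0 and the bound would hold trivially.
    rcases eq_or_ne (volume.real (crossSection Ω L)) 0 with h0 | h0
    · rw [h0]
      simp only [div_zero, zero_mul]
      positivity
    · exact le_of_eq (by field_simp)
  simp only [smoothJ]
  rw [mul_sub] at h4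
  linarith

/-- Coercivity of the functional. -/
lemma exists_le_smoothJ (d : ℕ) (K : ℝ) :
    ∃ c : ℝ, 0 ≤ c ∧ ∀ (Ω : Set (EuclideanSpace ℝ (Fin (d + 1))))
      (T S : EuclideanSpace ℝ (Fin (d + 1)) → EuclideanSpace ℝ (Fin (d + 1))),
      IsSliceMap K (unitCylinder d) Ω S T → IsSliceMap K Ω (unitCylinder d) T S →
      ∀ (Θ : ℝ → ℝ) (lam Lam m₀ L : ℝ), IsElliptic lam Lam Θ → 0 < m₀ → 0 < L →
      ∀ v : EuclideanSpace ℝ (Fin (d + 1)) → ℝ, ContDiff ℝ 1 v →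
        lam / 2 * (∫ x in truncNozzle Ω L, ‖gradient v x‖ ^ 2) -
          m₀ / volume.real (crossSection Ω L) * (c *
            (√(volume.real (crossSection Ω (-L)) *
              ∫ x' in crossSection Ω (-L), ‖v (slicePoint x' (-L))‖ ^ 2) +
            √(volume.real (truncNozzle Ω L) *
              ∫ x in truncNozzle Ω L, ‖gradient v x‖ ^ 2))) ≤ smoothJ Ω Θ m₀ L v := by
  obtain ⟨c, hc⟩ := exists_flux_le d K
  refine ⟨c, c.2, fun Ω T S h h' Θ lam Lam m₀ L hE hm hL v hv => ?_⟩
  have hf1 := h.isFiniteMeasure_truncNozzle h' L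
  have hf2 := h.isFiniteMeasure_crossSection h' L
  have hf3 := h.isFiniteMeasure_crossSection h' (-L)
  have hg2 := h.memLp_truncNozzle h' L hv.continuous_gradient
  have hv2 := h.memLp_crossSection h' (-L) hv.continuous
  have h1 : lam / 2 * (∫ x in truncNozzle Ω L, ‖gradient v x‖ ^ 2) ≤
      ∫ x in truncNozzle Ω L, energyDensity Θ (‖gradient v x‖ ^ 2) := by
    rw [← integral_const_mul]
    exact integral_mono ((hg2.integrable_norm_pow two_ne_zero).const_mul _)
      (h.integrable_energy h' hE L hv) fun x => hE.le_energyDensity (norm_nonneg _)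
  have h2 : ∫ x' in crossSection Ω L, v (slicePoint x' L) ≤ c *
      ((∫ x' in crossSection Ω (-L), ‖v (slicePoint x' (-L))‖) +
        ∫ x in truncNozzle Ω L, ‖gradient v x‖) := by
    refine (Real.le_norm_self _).trans ((norm_integral_le_integral_norm _).trans ?_)
    have hi1 := (hv2.integrable one_le_two).norm
    have hi2 := (hg2.integrable one_le_two).norm
    rw [integral_norm_eq_lintegral_enorm
        (h.memLp_crossSection h' L hv.continuous).aestronglyMeasurable,
      integral_norm_eq_lintegral_enorm hv2.aestronglyMeasurable,
      integral_norm_eq_lintegral_enorm hg2.aestronglyMeasurable,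
      ← ENNReal.toReal_add (hv2.integrable one_le_two).2.ne (hg2.integrable one_le_two).2.ne,
      ← ENNReal.coe_toReal, ← ENNReal.toReal_mul]
    refine ENNReal.toReal_mono (ENNReal.mul_ne_top ENNReal.coe_ne_top (ENNReal.add_ne_top.2
      ⟨(hv2.integrable one_le_two).2.ne, (hg2.integrable one_le_two).2.ne⟩))
      (hc Ω T S h h' L hL v hv)
  -- Cauchy–Schwarz brings in the volume of Ω_L, which later turns the energy into an average.
  have h3 := integral_norm_le_sqrt hv2
  have h4 := integral_norm_le_sqrt hg2
  rw [measureReal_restrict_apply_univ] at h3 h4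
  have h5 : ∫ x' in crossSection Ω L, v (slicePoint x' L) ≤ c *
      (√(volume.real (crossSection Ω (-L)) *
              ∫ x' in crossSection Ω (-L), ‖v (slicePoint x' (-L))‖ ^ 2) +
            √(volume.real (truncNozzle Ω L) *
              ∫ x in truncNozzle Ω L, ‖gradient v x‖ ^ 2)) :=
    h2.trans (mul_le_mul_of_nonneg_left (add_le_add h3 h4) c.2)
  have h6 := mul_le_mul_of_nonneg_left h5
    (div_nonneg hm.le (measureReal_nonneg (μ := volume) (s := crossSection Ω L)))
  simp only [smoothJ]
  linarith

end SmoothFunctional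

/-! ### The functional on `H_L` as a limit -/

section Limits

variable {d : ℕ} {K : ℝ} {Ω : Set (EuclideanSpace ℝ (Fin (d + 1)))}
  {T S : EuclideanSpace ℝ (Fin (d + 1)) → EuclideanSpace ℝ (Fin (d + 1))}
  {Θ : ℝ → ℝ} {lam Lam m₀ L : ℝ}

/-- Factor |a|² − |b|²; this is the quadratic growth condition of
`tendsto_integral_comp_of_tendsto_eLpNorm`. -/
lemma IsElliptic.abs_energyDensity_norm_sub_le (hE : IsElliptic lam Lam Θ) {E : Type*}
    [NormedAddCommGroup E] (a b : E) :
    |energyDensity Θ (‖a‖ ^ 2) - energyDensity Θ (‖b‖ ^ 2)| ≤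
      Lam / 2 * (‖a - b‖ * (‖a‖ + ‖b‖)) := by
  have hLam : 0 ≤ Lam := (abs_nonneg _).trans (hE.le_upper 0 le_rfl)
  refine (hE.abs_energyDensity_sub_le (sq_nonneg _) (sq_nonneg _)).trans ?_
  gcongr
  rw [sq_sub_sq, abs_mul, abs_of_nonneg (by positivity), mul_comm]
  gcongr
  exact abs_norm_sub_norm_le a b

lemma abs_norm_sq_sub_le {E : Type*} [NormedAddCommGroup E] (a b : E) :
    |‖a‖ ^ 2 - ‖b‖ ^ 2| ≤ 1 * (‖a - b‖ * (‖a‖ + ‖b‖)) := by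
  rw [sq_sub_sq, abs_mul, abs_of_nonneg (by positivity), mul_comm, one_mul]
  gcongr
  exact abs_norm_sub_norm_le a b

/-- The `C¹` functions `v k` tend to `u` in `H¹(Ω_L)`. -/
structure TendstoH1 (Ω : Set (EuclideanSpace ℝ (Fin (d + 1)))) (L : ℝ)
    (v : ℕ → EuclideanSpace ℝ (Fin (d + 1)) → ℝ) (u : EuclideanSpace ℝ (Fin (d + 1)) → ℝ) :
    Prop where
  contDiff : ∀ k, ContDiff ℝ 1 (v k)
  memH1 : MemH1 (truncNozzle Ω L) u
  tendsto : Tendsto (fun k => eLpNorm (fun x => v k x - u x) 2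
    (volume.restrict (truncNozzle Ω L))) atTop (𝓝 0)
  tendsto_gradient : Tendsto (fun k => eLpNorm
    (fun x => gradient (v k) x - weakGradient (truncNozzle Ω L) u x) 2
      (volume.restrict (truncNozzle Ω L))) atTop (𝓝 0)

variable {v v' : ℕ → EuclideanSpace ℝ (Fin (d + 1)) → ℝ}
  {u : EuclideanSpace ℝ (Fin (d + 1)) → ℝ}

/-- The trace inequality applied to the differences f − f'. -/
lemma IsSliceMap.tendsto_outlet_zero (h : IsSliceMap K (unitCylinder d) Ω S T)
    (h' : IsSliceMap K Ω (unitCylinder d) T S) (hL : 0 < L) {ι : Type*} {l : Filter ι}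
    {f f' : ι → EuclideanSpace ℝ (Fin (d + 1)) → ℝ} (hf : ∀ i, ContDiff ℝ 1 (f i))
    (hf' : ∀ i, ContDiff ℝ 1 (f' i))
    (h0 : Tendsto (fun i => eLpNorm (fun x => f i x - f' i x) 2
      (volume.restrict (truncNozzle Ω L))) l (𝓝 0))
    (h1 : Tendsto (fun i => eLpNorm (fun x => gradient (f i) x - gradient (f' i) x) 2
      (volume.restrict (truncNozzle Ω L))) l (𝓝 0)) :
    Tendsto (fun i => eLpNorm (fun x' => f i (slicePoint x' L) - f' i (slicePoint x' L)) 2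
      (volume.restrict (crossSection Ω L))) l (𝓝 0) := by
  obtain ⟨A, hA⟩ := h.exists_eLpNorm_trace_le h' hL
  have h2 := ENNReal.Tendsto.const_mul (a := (A : ℝ≥0∞)) (h0.add h1)
    (Or.inr ENNReal.coe_ne_top)
  rw [add_zero, mul_zero] at h2
  refine tendsto_of_tendsto_of_tendsto_of_le_of_le tendsto_const_nhds h2 (fun _ => zero_le)
    fun i => ?_
  have h3 := hA (fun x => f i x - f' i x) ((hf i).sub (hf' i))
  rwa [show gradient (fun x => f i x - f' i x) = fun x => gradient (f i) x - gradient (f' i) x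
    from funext fun x => gradient_sub_apply (hf i) (hf' i) x] at h3

/-- The Poincaré inequality applied to the differences f − f': inlet values and gradients control
the functions. -/
lemma IsSliceMap.tendsto_domain_zero (h : IsSliceMap K (unitCylinder d) Ω S T)
    (h' : IsSliceMap K Ω (unitCylinder d) T S) (hL : 0 < L) {ι : Type*} {l : Filter ι}
    {f f' : ι → EuclideanSpace ℝ (Fin (d + 1)) → ℝ} (hf : ∀ i, ContDiff ℝ 1 (f i))
    (hf' : ∀ i, ContDiff ℝ 1 (f' i))
    (h0 : Tendsto (fun i => eLpNorm
      (fun x' => f i (slicePoint x' (-L)) - f' i (slicePoint x' (-L))) 2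
      (volume.restrict (crossSection Ω (-L)))) l (𝓝 0))
    (h1 : Tendsto (fun i => eLpNorm (fun x => gradient (f i) x - gradient (f' i) x) 2
      (volume.restrict (truncNozzle Ω L))) l (𝓝 0)) :
    Tendsto (fun i => eLpNorm (fun x => f i x - f' i x) 2
      (volume.restrict (truncNozzle Ω L))) l (𝓝 0) := by
  obtain ⟨A, hA⟩ := h.exists_eLpNorm_poincare_le h' hL
  have h2 := ENNReal.Tendsto.const_mul (a := (A : ℝ≥0∞)) (h0.add h1)
    (Or.inr ENNReal.coe_ne_top)
  rw [add_zero, mul_zero] at h2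
  refine tendsto_of_tendsto_of_tendsto_of_le_of_le tendsto_const_nhds h2 (fun _ => zero_le)
    fun i => ?_
  have h3 := hA (fun x => f i x - f' i x) ((hf i).sub (hf' i))
  rwa [show gradient (fun x => f i x - f' i x) = fun x => gradient (f i) x - gradient (f' i) x
    from funext fun x => gradient_sub_apply (hf i) (hf' i) x] at h3

lemma TendstoH1.memLp_gradient (hv : TendstoH1 Ω L v u) :
    MemLp (weakGradient (truncNozzle Ω L) u) 2 (volume.restrict (truncNozzle Ω L)) :=
  hv.memH1.isWeakGradient.1

lemma HasTrace.tendstoH1 {t : ℝ} {τ : EuclideanSpace ℝ (Fin d) → ℝ}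
    (hu : MemH1 (truncNozzle Ω L) u) (hτ : HasTrace Ω L t u τ) :
    ∃ v, TendstoH1 Ω L v u ∧ Tendsto (fun k => eLpNorm (fun x' => v k (slicePoint x' t) - τ x') 2
        (volume.restrict (crossSection Ω t))) atTop (𝓝 0) := by
  obtain ⟨v, hv1, hv2, hv3, hv4⟩ := hτ.2
  exact ⟨v, ⟨hv1, hu, hv2, hv3⟩, hv4⟩

/-- By the trace inequality the outlet values form a Cauchy sequence in L², whose limit is the
trace. -/
lemma TendstoH1.exists_hasTrace (h : IsSliceMap K (unitCylinder d) Ω S T)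
    (h' : IsSliceMap K Ω (unitCylinder d) T S) (hL : 0 < L) (hv : TendstoH1 Ω L v u) :
    ∃ τ, HasTrace Ω L L u τ ∧
      Tendsto (fun k => eLpNorm (fun x' => v k (slicePoint x' L) - τ x') 2
        (volume.restrict (crossSection Ω L))) atTop (𝓝 0) := by
  have hval := tendsto_eLpNorm_cauchy_of_tendsto
    (fun k => (h.memLp_truncNozzle h' L (hv.contDiff k).continuous).1) hv.memH1.1.1 hv.tendsto
  have hgrad := tendsto_eLpNorm_cauchy_of_tendsto
    (fun k => (h.memLp_truncNozzle h' L (hv.contDiff k).continuous_gradient).1)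
    hv.memLp_gradient.1 hv.tendsto_gradient
  have hout := h.tendsto_outlet_zero h' hL (f := fun q : ℕ × ℕ => v q.1)
    (f' := fun q => v q.2) (fun q => hv.contDiff q.1) (fun q => hv.contDiff q.2) hval hgrad
  have hmem : ∀ k, MemLp (fun x' => v k (slicePoint x' L)) 2
      (volume.restrict (crossSection Ω L)) := fun k =>
    h.memLp_crossSection h' L (hv.contDiff k).continuous
  obtain ⟨τ, hτ, hτv⟩ := exists_tendsto_eLpNorm_of_cauchy hmem hout
  exact ⟨τ, ⟨hτ, v, hv.contDiff, hv.tendsto, hv.tendsto_gradient, hτv⟩, hτv⟩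

/-- The trace at the outlet does not depend on the approximating sequence. -/
lemma TendstoH1.trace_ae_eq (h : IsSliceMap K (unitCylinder d) Ω S T)
    (h' : IsSliceMap K Ω (unitCylinder d) T S) (hL : 0 < L) (hv : TendstoH1 Ω L v u)
    (hv' : TendstoH1 Ω L v' u) {τ τ' : EuclideanSpace ℝ (Fin d) → ℝ}
    (hτm : AEStronglyMeasurable τ (volume.restrict (crossSection Ω L)))
    (hτm' : AEStronglyMeasurable τ' (volume.restrict (crossSection Ω L)))
    (hτ : Tendsto (fun k => eLpNorm (fun x' => v k (slicePoint x' L) - τ x') 2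
        (volume.restrict (crossSection Ω L))) atTop (𝓝 0))
    (hτ' : Tendsto (fun k => eLpNorm (fun x' => v' k (slicePoint x' L) - τ' x') 2
        (volume.restrict (crossSection Ω L))) atTop (𝓝 0)) :
    τ =ᵐ[volume.restrict (crossSection Ω L)] τ' := by
  have hval := tendsto_eLpNorm_sub_of_tendsto
    (fun k => (h.memLp_truncNozzle h' L (hv.contDiff k).continuous).1)
    (fun k => (h.memLp_truncNozzle h' L (hv'.contDiff k).continuous).1)
    hv.memH1.1.1 hv.tendsto hv'.tendsto
  have hgrad := tendsto_eLpNorm_sub_of_tendsto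
    (fun k => (h.memLp_truncNozzle h' L (hv.contDiff k).continuous_gradient).1)
    (fun k => (h.memLp_truncNozzle h' L (hv'.contDiff k).continuous_gradient).1)
    hv.memLp_gradient.1 hv.tendsto_gradient hv'.tendsto_gradient
  exact ae_eq_of_tendsto_eLpNorm
    (fun k => (h.memLp_crossSection h' L (hv.contDiff k).continuous).1)
    (fun k => (h.memLp_crossSection h' L (hv'.contDiff k).continuous).1) hτm hτm' hτ hτ'
    (h.tendsto_outlet_zero h' hL hv.contDiff hv'.contDiff hval hgrad)

/-- Traces at the outlet exist and are unique. -/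
lemma TendstoH1.tendsto_traceOn (h : IsSliceMap K (unitCylinder d) Ω S T)
    (h' : IsSliceMap K Ω (unitCylinder d) T S) (hL : 0 < L) (hv : TendstoH1 Ω L v u) :
    MemLp (traceOn Ω L L u) 2 (volume.restrict (crossSection Ω L)) ∧
    Tendsto (fun k => eLpNorm (fun x' => v k (slicePoint x' L) - traceOn Ω L L u x') 2
        (volume.restrict (crossSection Ω L))) atTop (𝓝 0) := by
  obtain ⟨τ, hτ, hτv⟩ := hv.exists_hasTrace h h' hL
  have hspec : HasTrace Ω L L u (traceOn Ω L L u) := by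
    have hex : ∃ τ, HasTrace Ω L L u τ := ⟨τ, hτ⟩
    rw [traceOn, dif_pos hex]
    exact hex.choose_spec
  -- The chosen trace comes with its own approximants w; uniqueness identifies it with the limit
  -- along v.
  obtain ⟨w, hw, hwτ⟩ := hspec.tendstoH1 hv.memH1
  have hae := hv.trace_ae_eq h h' hL hw hτ.1.1 hspec.1.1 hτv hwτ
  refine ⟨hspec.1, hτv.congr fun k => eLpNorm_congr_ae ?_⟩
  filter_upwards [hae] with x hx
  rw [hx]

/-- The functional at `u` is the limit of its values at smooth approximants. -/
lemma TendstoH1.tendsto_smoothJ (h : IsSliceMap K (unitCylinder d) Ω S T)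
    (h' : IsSliceMap K Ω (unitCylinder d) T S) (hE : IsElliptic lam Lam Θ) (hL : 0 < L)
    (hv : TendstoH1 Ω L v u) :
    Tendsto (fun k => smoothJ Ω Θ m₀ L (v k)) atTop (𝓝 (functionalJ Ω Θ m₀ L u)) := by
  have hf := h.isFiniteMeasure_crossSection h' L
  obtain ⟨hτ, hτv⟩ := hv.tendsto_traceOn h h' hL
  have h1 := tendsto_integral_comp_of_tendsto_eLpNorm
    (Φ := fun x : EuclideanSpace ℝ (Fin (d + 1)) => energyDensity Θ (‖x‖ ^ 2))
    hE.continuous_energyDensity_norm_sq (by simp [energyDensity_zero])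
    hE.abs_energyDensity_norm_sub_le
    (fun k => h.memLp_truncNozzle h' L (hv.contDiff k).continuous_gradient) hv.memLp_gradient
    hv.tendsto_gradient
  have h2 := tendsto_integral_mul_of_tendsto_eLpNorm (φ := fun _ => (1 : ℝ))
    (fun k => h.memLp_crossSection h' L (hv.contDiff k).continuous) hτ (memLp_const 1) hτv
  simp only [mul_one] at h2
  exact h1.sub (h2.const_mul _)

lemma TendstoH1.tendsto_integral_norm_sq (h : IsSliceMap K (unitCylinder d) Ω S T)
    (h' : IsSliceMap K Ω (unitCylinder d) T S) (hv : TendstoH1 Ω L v u) :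
    Tendsto (fun k => ∫ x in truncNozzle Ω L, ‖gradient (v k) x‖ ^ 2) atTop
      (𝓝 (∫ x in truncNozzle Ω L, ‖weakGradient (truncNozzle Ω L) u x‖ ^ 2)) :=
  tendsto_integral_comp_of_tendsto_eLpNorm
    (Φ := fun x : EuclideanSpace ℝ (Fin (d + 1)) => ‖x‖ ^ 2) (by fun_prop) (by simp)
    abs_norm_sq_sub_le
    (fun k => h.memLp_truncNozzle h' L (hv.contDiff k).continuous_gradient) hv.memLp_gradient
    hv.tendsto_gradient

/-- The vanishing inlet trace is itself defined through C¹ approximants, and these are the sequence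
wanted. -/
lemma exists_tendstoH1_of_mem_spaceHL (h : IsSliceMap K (unitCylinder d) Ω S T)
    (h' : IsSliceMap K Ω (unitCylinder d) T S) (hu : u ∈ spaceHL Ω L) :
    ∃ v, TendstoH1 Ω L v u ∧ Tendsto (fun k => ∫ x' in crossSection Ω (-L),
      ‖v k (slicePoint x' (-L))‖ ^ 2) atTop (𝓝 0) := by
  obtain ⟨v, hv, hv0⟩ := hu.2.tendstoH1 hu.1
  refine ⟨v, hv, ?_⟩
  have := tendsto_integral_comp_of_tendsto_eLpNorm (Φ := fun x : ℝ => ‖x‖ ^ 2)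
    (by fun_prop) (by simp) abs_norm_sq_sub_le
    (fun k => h.memLp_crossSection h' (-L) (hv.contDiff k).continuous) hu.2.1 hv0
  simpa using this

/-- `H¹` limits of `C¹` functions vanishing asymptotically at the inlet belong to `H_L`. -/
lemma exists_mem_spaceHL_of_cauchy (h : IsSliceMap K (unitCylinder d) Ω S T)
    (h' : IsSliceMap K Ω (unitCylinder d) T S) (hL : 0 < L) (hv : ∀ k, ContDiff ℝ 1 (v k))
    (h0 : Tendsto (fun k => ∫ x' in crossSection Ω (-L), ‖v k (slicePoint x' (-L))‖ ^ 2)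
      atTop (𝓝 0))
    (h1 : Tendsto (fun q : ℕ × ℕ => ∫ x in truncNozzle Ω L,
      ‖gradient (v q.1) x - gradient (v q.2) x‖ ^ 2) atTop (𝓝 0)) :
    ∃ u, u ∈ spaceHL Ω L ∧ TendstoH1 Ω L v u := by
  have hU := isOpen_truncNozzle h'.isOpen L
  have hvm : ∀ k, MemLp (v k) 2 (volume.restrict (truncNozzle Ω L)) := fun k =>
    h.memLp_truncNozzle h' L (hv k).continuous
  have hgm : ∀ k, MemLp (gradient (v k)) 2 (volume.restrict (truncNozzle Ω L)) := fun k =>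
    h.memLp_truncNozzle h' L (hv k).continuous_gradient
  have him := fun k => h.memLp_crossSection h' (-L) (hv k).continuous
  have hin := tendsto_eLpNorm_two_zero him h0
  have hgc := tendsto_eLpNorm_two_zero (fun q : ℕ × ℕ => (hgm q.1).sub (hgm q.2)) h1
  have hinc := tendsto_eLpNorm_cauchy_of_tendsto (g := fun _ => (0 : ℝ))
    (fun k => (him k).1) aestronglyMeasurable_const (by simpa using hin)
  have hvc := h.tendsto_domain_zero h' hL (f := fun q : ℕ × ℕ => v q.1)
    (f' := fun q => v q.2) (fun q => hv q.1) (fun q => hv q.2) hinc hgc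
  obtain ⟨g, hg, hgt⟩ := exists_tendsto_eLpNorm_of_cauchy hgm hgc
  obtain ⟨u, hu, hut⟩ := exists_tendsto_eLpNorm_of_cauchy hvm hvc
  have hwg : IsWeakGradient (truncNozzle Ω L) u g :=
    isWeakGradient_of_tendsto hvm
      (fun k => isWeakGradient_gradient hU (h.isBounded_truncNozzle h' L) (hv k)) hu hg hut hgt
  have hae := hwg.weakGradient_ae_eq hU hu
  have hgt' : Tendsto (fun k => eLpNorm
      (fun x => gradient (v k) x - weakGradient (truncNozzle Ω L) u x) 2
      (volume.restrict (truncNozzle Ω L))) atTop (𝓝 0) := by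
    refine hgt.congr fun k => eLpNorm_congr_ae ?_
    filter_upwards [hae] with x hx
    rw [hx]
  refine ⟨u, ⟨⟨hu, g, hwg⟩, MemLp.zero, v, hv, hut, hgt', ?_⟩, hv, ⟨hu, g, hwg⟩, hut, hgt'⟩
  simpa using hin

/-- Since v k ≥ 0, the negative part of u is at most |v k − u| pointwise, so its L² norm is 0. -/
lemma ae_nonneg_of_tendstoH1 (hv : TendstoH1 Ω L v u) (h0 : ∀ k x, 0 ≤ v k x) :
    ∀ᵐ x ∂(volume.restrict (truncNozzle Ω L)), 0 ≤ u x := by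
  have hm : AEStronglyMeasurable (fun x => min (u x) 0)
      (volume.restrict (truncNozzle Ω L)) := hv.memH1.1.1.inf aestronglyMeasurable_const
  have h1 : eLpNorm (fun x => min (u x) 0) 2 (volume.restrict (truncNozzle Ω L)) ≤ 0 := by
    refine ge_of_tendsto' hv.tendsto fun k => eLpNorm_mono fun x => ?_
    have := h0 k x
    rw [Real.norm_eq_abs, Real.norm_eq_abs]
    rcases le_total (u x) 0 with hx | hx
    · rw [min_eq_left hx, abs_of_nonpos hx, abs_of_nonneg (by linarith)]
      linarith
    · rw [min_eq_right hx, abs_zero]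
      exact abs_nonneg _
  filter_upwards [(eLpNorm_eq_zero_iff hm two_ne_zero).1 (le_antisymm h1 zero_le)] with x hx
  exact min_eq_right_iff.1 hx

/-- The zero function is admissible, with zero energy. -/
lemma zero_mem_spaceHL (h : IsSliceMap K (unitCylinder d) Ω S T)
    (h' : IsSliceMap K Ω (unitCylinder d) T S) (hE : IsElliptic lam Lam Θ) (hL : 0 < L) :
    ∃ u ∈ spaceHL Ω L, functionalJ Ω Θ m₀ L u = 0 := by
  have hgrad : ∀ x, gradient (fun _ : EuclideanSpace ℝ (Fin (d + 1)) => (0 : ℝ)) x = 0 := by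
    intro x
    simp [gradient]
  -- Taking u as limit of the constant sequence 0 yields J(u) = 0 by continuity, without inspecting
  -- the chosen weak gradient and trace.
  obtain ⟨u, hu, hvu⟩ := exists_mem_spaceHL_of_cauchy (v := fun _ _ => 0) h h' hL
    (fun _ => contDiff_const) (by simp) (by simp)
  refine ⟨u, hu, ?_⟩
  have h1 := hvu.tendsto_smoothJ (m₀ := m₀) h h' hE hL
  have h2 : smoothJ Ω Θ m₀ L (fun _ => 0) = 0 := by
    simp [smoothJ, hgrad, energyDensity_zero]
  simp only [h2] at h1
  exact tendsto_nhds_unique h1 tendsto_const_nhds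

/-- Existence of a nonnegative minimizer. -/
lemma IsSliceMap.exists_nonneg_minimizer (h : IsSliceMap K (unitCylinder d) Ω S T)
    (h' : IsSliceMap K Ω (unitCylinder d) T S) (hE : IsElliptic lam Lam Θ) (hL : 0 < L)
    (hm : 0 < m₀) :
    ∃ u, IsMinimizerJ Ω Θ m₀ L u ∧
      ∀ᵐ x ∂(volume.restrict (truncNozzle Ω L)), 0 ≤ u x := by
  set E := smoothJ Ω Θ m₀ L with hEdef
  set B : (EuclideanSpace ℝ (Fin (d + 1)) → ℝ) → ℝ := fun v =>
    ∫ x' in crossSection Ω (-L), ‖v (slicePoint x' (-L))‖ ^ 2 with hB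
  set r : ℕ → ℝ := fun k => 1 / ((k : ℝ) + 1) with hr
  have hrpos : ∀ k, 0 < r k := fun k => by positivity
  have hr0 : Tendsto r atTop (𝓝 0) := tendsto_one_div_add_atTop_nhds_zero_nat
  have hranti : Antitone r := fun j k hjk => by
    simp only [hr]
    gcongr
  -- The inlet condition is relaxed to a bound r k → 0, so that the competitors can be C¹; the sets
  -- shrink and their infima I k increase.
  set Adm : ℕ → Set (EuclideanSpace ℝ (Fin (d + 1)) → ℝ) := fun k =>
    {v | ContDiff ℝ 1 v ∧ B v ≤ r k} with hAdm
  have hAdmAnti : Antitone Adm := fun j k hjk v hv => ⟨hv.1, hv.2.trans (hranti hjk)⟩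
  have hBint : ∀ {v}, ContDiff ℝ 1 v → Integrable
      (fun x' : EuclideanSpace ℝ (Fin d) => ‖v (slicePoint x' (-L))‖ ^ 2)
      (volume.restrict (crossSection Ω (-L))) := fun hv =>
    (h.memLp_crossSection h' (-L) hv.continuous).integrable_norm_pow two_ne_zero
  have hgrad0 : ∀ x, gradient (fun _ : EuclideanSpace ℝ (Fin (d + 1)) => (0 : ℝ)) x = 0 := by
    intro x
    simp [gradient]
  have hE0 : E (fun _ => 0) = 0 := by
    simp [hEdef, smoothJ, hgrad0, energyDensity_zero]
  have h0mem : ∀ k, (fun _ => (0 : ℝ)) ∈ Adm k := fun k =>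
    ⟨contDiff_const, by simpa [hB] using (hrpos k).le⟩
  obtain ⟨c, hc0, hc⟩ := exists_le_smoothJ d K
  set M := m₀ / volume.real (crossSection Ω L) with hM
  have hM0 : 0 ≤ M := div_nonneg hm.le measureReal_nonneg
  obtain ⟨b, hb⟩ : ∃ b : ℝ, ∀ k, ∀ v ∈ Adm k, b ≤ E v := by
    refine ⟨-(M * (c * √(volume.real (crossSection Ω (-L))))) -
      (M * c) ^ 2 * volume.real (truncNozzle Ω L) / (2 * lam), fun k v hv => ?_⟩
    have h1 := hc Ω T S h h' Θ lam Lam m₀ L hE hm hL v hv.1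
    have hlam := hE.lam_pos
    set P := ∫ x in truncNozzle Ω L, ‖gradient v x‖ ^ 2
    have hP : 0 ≤ P := integral_nonneg fun x => by positivity
    have hV : 0 ≤ volume.real (truncNozzle Ω L) := measureReal_nonneg
    have h2 : √(volume.real (crossSection Ω (-L)) * B v) ≤
        √(volume.real (crossSection Ω (-L))) := by
      refine Real.sqrt_le_sqrt (mul_le_of_le_one_right measureReal_nonneg (hv.2.trans ?_))
      simp only [hr]
      rw [div_le_one (by positivity)]
      linarith [Nat.cast_nonneg (α := ℝ) k]
    -- Young's inequality with weights chosen so that the gradient term is absorbed exactly by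
    -- (lam/2)P.
    have h3 : M * c * √(volume.real (truncNozzle Ω L) * P) ≤
        lam / 2 * P + (M * c) ^ 2 * volume.real (truncNozzle Ω L) / (2 * lam) := by
      have hs := Real.sq_sqrt hP
      have hs' := Real.sq_sqrt hV
      rw [Real.sqrt_mul hV]
      set p := √P
      set q := √(volume.real (truncNozzle Ω L))
      rw [← hs, ← hs']
      have : 0 ≤ (lam * p - M * c * q) ^ 2 / (2 * lam) := by positivity
      have e : (lam * p - M * c * q) ^ 2 / (2 * lam) =
          lam / 2 * p ^ 2 + (M * c) ^ 2 * q ^ 2 / (2 * lam) - M * c * (q * p) := by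
        field_simp
        ring
      linarith
    have h4 : M * (c * √(volume.real (crossSection Ω (-L)) * B v)) ≤
        M * (c * √(volume.real (crossSection Ω (-L)))) := by gcongr
    have h5 : lam / 2 * P - M * (c * (√(volume.real (crossSection Ω (-L)) * B v) +
        √(volume.real (truncNozzle Ω L) * P))) ≤ E v := h1
    rw [mul_add, mul_add] at h5
    linarith
  set I : ℕ → ℝ := fun k => sInf (E '' Adm k) with hI
  have hbdd : ∀ k, BddBelow (E '' Adm k) := fun k =>
    ⟨b, by rintro _ ⟨v, hv, rfl⟩; exact hb k v hv⟩
  have hIle : ∀ {k v}, v ∈ Adm k → I k ≤ E v := fun {k v} hv =>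
    csInf_le (hbdd k) (mem_image_of_mem _ hv)
  have hImono : Monotone I := fun j k hjk =>
    csInf_le_csInf (hbdd j) ⟨_, mem_image_of_mem _ (h0mem k)⟩ (image_mono (hAdmAnti hjk))
  have hIbdd : BddAbove (range I) := by
    refine ⟨0, ?_⟩
    rintro _ ⟨k, rfl⟩
    exact hE0 ▸ hIle (h0mem k)
  set Is := ⨆ k, I k with hIs
  have hIlim : Tendsto I atTop (𝓝 Is) := tendsto_atTop_ciSup hImono hIbdd
  have hexw : ∀ k, ∃ w, w ∈ Adm k ∧ (∀ x, 0 ≤ w x) ∧ E w ≤ I k + r k := by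
    intro k
    obtain ⟨_, ⟨v, hv, rfl⟩, hvlt⟩ := exists_lt_of_csInf_lt
      (⟨_, mem_image_of_mem _ (h0mem k)⟩ : (E '' Adm k).Nonempty)
      (by linarith [hrpos k] : sInf (E '' Adm k) < I k + r k / 2)
    -- With ε = r k/(2m₀), making the competitor nonnegative costs r k/2, the other half of the
    -- allowance.
    obtain ⟨w, hw, hw0, hwv, hEw⟩ := h.exists_nonneg_smoothJ_le (L := L) h' hE hm hv.1
      (div_pos (hrpos k) (mul_pos two_pos hm))
    refine ⟨w, ⟨hw, le_trans ?_ hv.2⟩, hw0, ?_⟩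
    · refine integral_mono (hBint hw) (hBint hv.1) fun x' => ?_
      exact pow_le_pow_left₀ (norm_nonneg _) (hwv _) 2
    · have e : m₀ * (r k / (2 * m₀)) = r k / 2 := by field_simp
      rw [e] at hEw
      change E w ≤ E v + r k / 2 at hEw
      linarith
  choose w hwA hw0 hwE using hexw
  have hEw : Tendsto (fun k => E (w k)) atTop (𝓝 Is) := by
    refine tendsto_of_tendsto_of_tendsto_of_le_of_le hIlim ?_ (fun k => hIle (hwA k)) hwE
    simpa using hIlim.add hr0
  -- The inlet norm is convex, so midpoints stay admissible at the coarser level and their energy is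
  -- at least I n.
  have hmid : ∀ n j k, n ≤ j → n ≤ k →
      (fun x => (1 / 2 : ℝ) * (w j x + w k x)) ∈ Adm n := by
    intro n j k hj hk
    refine ⟨contDiff_const.mul ((hwA j).1.add (hwA k).1), ?_⟩
    have h1 : B (fun x => (1 / 2 : ℝ) * (w j x + w k x)) ≤ (B (w j) + B (w k)) / 2 := by
      rw [hB]
      simp only
      rw [← integral_add (hBint (hwA j).1) (hBint (hwA k).1), ← integral_div]
      refine integral_mono (hBint (contDiff_const.mul ((hwA j).1.add (hwA k).1)))
        (((hBint (hwA j).1).add (hBint (hwA k).1)).div_const 2) fun x' => ?_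
      simp only [Real.norm_eq_abs, sq_abs]
      nlinarith [sq_nonneg (w j (slicePoint x' (-L)) - w k (slicePoint x' (-L)))]
    linarith [(hwA j).2.trans (hranti hj), (hwA k).2.trans (hranti hk)]
  -- Strong convexity bounds (lam/8)∫|∇w j − ∇w k|² by the mean energy minus I (min j k), and both
  -- tend to Is.
  have hcauchy : Tendsto (fun q : ℕ × ℕ => ∫ x in truncNozzle Ω L,
      ‖gradient (w q.1) x - gradient (w q.2) x‖ ^ 2) atTop (𝓝 0) := by
    have hlam := hE.lam_pos
    have hmin : Tendsto (fun q : ℕ × ℕ => min q.1 q.2) atTop atTop := by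
      rw [← prod_atTop_atTop_eq]
      exact tendsto_atTop.2 fun n => ((tendsto_fst.eventually_ge_atTop n).and
        (tendsto_snd.eventually_ge_atTop n)).mono fun q hq => le_min hq.1 hq.2
    have hlim : Tendsto (fun q : ℕ × ℕ =>
        8 / lam * ((E (w q.1) + E (w q.2)) / 2 - I (min q.1 q.2))) atTop
        (𝓝 (8 / lam * ((Is + Is) / 2 - Is))) := by
      refine Tendsto.const_mul _ (Tendsto.sub ?_ (hIlim.comp hmin))
      rw [← prod_atTop_atTop_eq]
      exact ((hEw.comp tendsto_fst).add (hEw.comp tendsto_snd)).div_const 2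
    rw [show 8 / lam * ((Is + Is) / 2 - Is) = 0 by ring] at hlim
    refine tendsto_of_tendsto_of_tendsto_of_le_of_le tendsto_const_nhds hlim
      (fun q => integral_nonneg fun x => by positivity) fun q => ?_
    have h1 := h.smoothJ_midpoint_le (m₀ := m₀) (L := L) h' hE (hwA q.1).1 (hwA q.2).1
    have h2 := hIle (hmid _ q.1 q.2 (min_le_left _ _) (min_le_right _ _))
    simp only
    rw [div_mul_eq_mul_div, le_div_iff₀ hlam]
    change E _ + _ ≤ (E _ + E _) / 2 at h1
    linarith
  have hBw : Tendsto (fun k => B (w k)) atTop (𝓝 0) :=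
    tendsto_of_tendsto_of_tendsto_of_le_of_le tendsto_const_nhds hr0
      (fun k => integral_nonneg fun x => by positivity) fun k => (hwA k).2
  obtain ⟨u, hu, hwu⟩ := exists_mem_spaceHL_of_cauchy h h' hL (fun k => (hwA k).1) hBw hcauchy
  refine ⟨u, ⟨hu, fun ψ hψ => ?_⟩, ae_nonneg_of_tendstoH1 hwu hw0⟩
  have hJu : functionalJ Ω Θ m₀ L u = Is :=
    tendsto_nhds_unique (hwu.tendsto_smoothJ h h' hE hL) hEw
  rw [hJu]
  obtain ⟨v, hv, hBv⟩ := exists_tendstoH1_of_mem_spaceHL h h' hψ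
  -- For each fixed k, the approximants of ψ eventually lie in Adm k, so J(ψ) ≥ I k; take the
  -- supremum over k.
  refine ciSup_le fun k => ge_of_tendsto (hv.tendsto_smoothJ h h' hE hL) ?_
  filter_upwards [hBv.eventually_le_const (hrpos k)] with n hn
  exact hIle ⟨hv.contDiff n, hn⟩

/-- Energy bound for minimizers. -/
lemma exists_energy_le (d : ℕ) (K : ℝ) :
    ∃ c : ℝ, 0 ≤ c ∧ ∀ (Ω : Set (EuclideanSpace ℝ (Fin (d + 1))))
      (T S : EuclideanSpace ℝ (Fin (d + 1)) → EuclideanSpace ℝ (Fin (d + 1))),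
      IsSliceMap K (unitCylinder d) Ω S T → IsSliceMap K Ω (unitCylinder d) T S →
      ∀ (Θ : ℝ → ℝ) (lam Lam m₀ L : ℝ), IsElliptic lam Lam Θ → 0 < m₀ → 0 < L →
      ∀ u, IsMinimizerJ Ω Θ m₀ L u →
        1 / volume.real (truncNozzle Ω L) *
          ∫ x in truncNozzle Ω L, ‖weakGradient (truncNozzle Ω L) u x‖ ^ 2 ≤
          c / lam ^ 2 * m₀ ^ 2 := by
  obtain ⟨c, hc0, hc⟩ := exists_le_smoothJ d K
  obtain ⟨a, ha⟩ := exists_le_volume_crossSection d K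
  set β := (volume (Metric.ball (0 : EuclideanSpace ℝ (Fin d)) 1)).toReal with hβ
  have hβ0 : 0 < β := ENNReal.toReal_pos (Metric.measure_ball_pos volume _ one_pos).ne'
    measure_ball_lt_top.ne
  -- Solving (lam/2)P ≤ m₀(a/β)c√(VP) for P gives this constant, where a/β bounds the inverse area
  -- of the outlet.
  refine ⟨(2 * (a / β) * c) ^ 2, sq_nonneg _,
    fun Ω T S h h' Θ lam Lam m₀ L hE hm hL u hu => ?_⟩
  have hlam := hE.lam_pos
  obtain ⟨v, hv, hBv⟩ := exists_tendstoH1_of_mem_spaceHL h h' hu.1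
  obtain ⟨z, hz, hJz⟩ := zero_mem_spaceHL (m₀ := m₀) h h' hE hL
  have hJ : functionalJ Ω Θ m₀ L u ≤ 0 := hJz ▸ hu.2 z hz
  set V := volume.real (truncNozzle Ω L)
  set P := ∫ x in truncNozzle Ω L, ‖weakGradient (truncNozzle Ω L) u x‖ ^ 2
  have hP0 : 0 ≤ P := integral_nonneg fun x => by positivity
  have hV0 : 0 ≤ V := measureReal_nonneg
  set M := m₀ / volume.real (crossSection Ω L) with hM
  have hM0 : 0 ≤ M := div_nonneg hm.le measureReal_nonneg
  have hMle : M ≤ m₀ * (a / β) := by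
    have hfin : volume (crossSection Ω L) ≠ ⊤ := (h.isBounded_crossSection h' L).measure_lt_top.ne
    have h1 := ENNReal.toReal_mono (ENNReal.mul_ne_top ENNReal.coe_ne_top hfin) (ha Ω T S h h' L)
    rw [ENNReal.toReal_mul, ENNReal.coe_toReal] at h1
    change β ≤ a * volume.real (crossSection Ω L) at h1
    have h2 : 0 < volume.real (crossSection Ω L) :=
      pos_of_mul_pos_right (hβ0.trans_le h1) a.2
    rw [hM, div_le_iff₀ h2]
    calc m₀ = m₀ / β * β := by field_simp
      _ ≤ m₀ / β * (a * volume.real (crossSection Ω L)) := by gcongr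
      _ = _ := by ring
  have hlim := hv.tendsto_integral_norm_sq h h'
  -- The coercivity estimate for the approximants passes to the limit; the inlet term disappears,
  -- and J(u) ≤ J(0) = 0.
  have h1 : lam / 2 * P - M * (c * (√(volume.real (crossSection Ω (-L)) * 0) + √(V * P))) ≤ 0 := by
    refine le_trans ?_ hJ
    refine le_of_tendsto_of_tendsto' ?_ (hv.tendsto_smoothJ h h' hE hL) fun k =>
      hc Ω T S h h' Θ lam Lam m₀ L hE hm hL (v k) (hv.contDiff k)
    refine (hlim.const_mul _).sub (Tendsto.const_mul _ (Tendsto.const_mul _ (Tendsto.add ?_ ?_)))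
    · exact (Real.continuous_sqrt.tendsto _).comp (hBv.const_mul _)
    · exact (Real.continuous_sqrt.tendsto _).comp (hlim.const_mul _)
  rw [mul_zero, Real.sqrt_zero, zero_add] at h1
  have h2 : lam * P ≤ 2 * (m₀ * (a / β)) * c * √(V * P) := by
    have : M * (c * √(V * P)) ≤ m₀ * (a / β) * (c * √(V * P)) := by gcongr
    linarith
  have h3 : P ≤ (2 * (a / β) * c) ^ 2 / lam ^ 2 * m₀ ^ 2 * V := by
    -- After squaring, one factor P is cancelled, which requires P > 0.
    rcases hP0.eq_or_lt with hP | hP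
    · rw [← hP]
      positivity
    · have h4 : (lam * P) ^ 2 ≤ (2 * (m₀ * (a / β)) * c) ^ 2 * (V * P) := by
        rw [← Real.sq_sqrt (mul_nonneg hV0 hP0), ← mul_pow]
        exact pow_le_pow_left₀ (by positivity) h2 2
      have h5 : lam ^ 2 * P ≤ (2 * (m₀ * (a / β)) * c) ^ 2 * V := by
        refine le_of_mul_le_mul_right ?_ hP
        linarith
      rw [div_mul_eq_mul_div, div_mul_eq_mul_div, le_div_iff₀ (by positivity)]
      linarith
  rcases hV0.eq_or_lt with hV | hV
  · rw [← hV, div_zero, zero_mul]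
    positivity
  · rw [one_div, inv_mul_le_iff₀ hV]
    linarith

end Limits

/-! ### Conclusion: existence and the uniform energy bound -/

theorem mainTheorem4 {d : ℕ} (hd : 1 ≤ d)
    (Ω : Set (EuclideanSpace ℝ (Fin (d + 1)))) (hΩ : IsNozzle Ω)
    (p ρ Θ : ℝ → ℝ) (δ : ℝ) (hp : IsPressureLaw p) (hρ : IsDensitySpeedRelation p ρ)
    (hΘ : IsSubsonicTruncation ρ δ Θ) :
    ∃ C : ℝ, 0 < C ∧ ∀ m₀ : ℝ, 0 < m₀ → ∀ L : ℝ, 0 < L →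
      (∃ φ : EuclideanSpace ℝ (Fin (d + 1)) → ℝ, IsMinimizerJ Ω Θ m₀ L φ ∧
        ∀ᵐ x ∂(volume.restrict (truncNozzle Ω L)), 0 ≤ φ x) ∧
      ∀ φ : EuclideanSpace ℝ (Fin (d + 1)) → ℝ, IsMinimizerJ Ω Θ m₀ L φ →
        1 / volume.real (truncNozzle Ω L) *
          ∫ x in truncNozzle Ω L, ‖weakGradient (truncNozzle Ω L) φ x‖ ^ 2 ≤ C * m₀ ^ 2 := by
  obtain ⟨hopen, α, -, K, T, S, hN⟩ := hΩ
  obtain ⟨lam, Lam, hE⟩ := hΘ.exists_isElliptic hp hρ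
  have h := hN.isSliceMap_symm
  have h' := hN.isSliceMap hopen
  obtain ⟨c, hc0, hc⟩ := exists_energy_le d K
  have hlam := hE.lam_pos
  -- Adding 1 makes the constant strictly positive, c being only known to be nonnegative.
  refine ⟨c / lam ^ 2 + 1, by positivity, fun m₀ hm L hL =>
    ⟨h.exists_nonneg_minimizer h' hE hL hm, fun φ hφ => ?_⟩⟩
  refine (hc Ω T S h h' Θ lam Lam m₀ L hE hm hL φ hφ).trans ?_
  gcongr
  linarith
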